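/- Let $\mathbb F$ be a finite real abelian extension of $\mathbb Q$, let $M$ be an odd positive integer, and let $\mathbf r$ be the formal product of all odd primes $\ell\equiv 1\bmod M$ that split completely in $\mathbb F$ (so the supernatural divisors $\mathbf s$ of $\mathbf r$ correspond to sets of such primes, and the positive integers $r\mid\mathbf r$ to finite ones). Let $\mathbb F_{\mathbf r}$ be the field generated over $\mathbb F$, inside an algebraic closure, by all roots of unity of order dividing $\mathbf r$, and let $G=\mathrm{Gal}(\mathbb F_{\mathbf r}/\mathbb F)$. For each prime $\ell\mid\mathbf r$ let $G_\ell\subset G$ be the inertia subgroup at the places above $\ell$ (cyclic of order $\ell-1$), let $\sigma_\ell$ be any generator of $G_\ell$, let $\mathrm{Frob}_\ell\in G/G_\ell$ be the arithmetic Frobenius at the places above $\ell$, and put $N'_\ell=\sum_{i=1}^{\ell-2}i\,\sigma_\ell^i\in\mathbb Z[G]$. For a positive integer $r\mid\mathbf r$ put $N'_r=\prod_{\ell\mid r}N'_\ell$. For $\mathbf s\mid\mathbf r$ let $\frac1{\mathbf s}\mathbb Z/\mathbb Z=\bigcup_{s\mid\mathbf s}\frac1s\mathbb Z/\mathbb Z\subset\mathbb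 Q/\mathbb Z$, the union being over positive integers $s\mid\mathbf s$. Let $\mathcal A(\mathbf s)$ be the free abelian group on symbols $[a]$, $a\in\frac1{\mathbf s}\mathbb Z/\mathbb Z$, and let $U_{\mathbf s}$ be the quotient of $\mathcal A(\mathbf s)$ by the subgroup generated by the elements $[a]-\sum_{\ell b=a}[b]$ with $\ell\mid\mathbf s$ prime and $a\in\frac{\ell}{\mathbf s}\mathbb Z/\mathbb Z$. The group $G$ acts on $\mathcal A(\mathbf s)$ and $U_{\mathbf s}$ by the rule that $\sigma[a]=[b]$ if and only if $\sigma\phi(a)=\phi(b)$, for every injective homomorphism $\phi:\frac1{\mathbf r}\mathbb Z/\mathbb Z\to\mathbb F_{\mathbf r}^\times$. Put $U=U_{\mathbf r}$; for $\mathbf s\mid\mathbf r$ the inclusion $\mathcal A(\mathbf s)\subset\mathcal A(\mathbf r)$ induces maps $U_{\mathbf s}\to U$ and $H^0(G,U_{\mathbf s}/MU_{\mathbf s})\to H^0(G,U/MU)$, through which elements are viewed in $U$ and in $H^0(G,U/MU)$ (these maps are injective by results of Kubert). For a prime $\ell\mid\mathbf r$ let $I_\ell\subset U$ be the subgroup generated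 by the classes of $[a]-[b]$ with $a-b\in\frac1\ell\mathbb Z/\mathbb Z$. For each prime $\ell\mid\mathbf r$ there is a unique homomorphism $$D_\ell:H^0(G,U/MU)\to H^0(G,U_{\mathbf r/\ell}/MU_{\mathbf r/\ell})$$ such that for all $x\in U$ and $y\in U_{\mathbf r/\ell}$ representing classes in $H^0(G,U/MU)$ and $H^0(G,U_{\mathbf r/\ell}/MU_{\mathbf r/\ell})$ respectively, $$\frac{(\sigma_\ell-1)x}{M}\equiv\frac{(\ell-\mathrm{Frob}_\ell)y}{M}\bmod I_\ell\iff D_\ell(x\bmod MU)=y\bmod MU_{\mathbf r/\ell}.$$ For each positive integer $r\mid\mathbf r$ let $x_r\in U_r$ be the class of the symbol $\left[\sum_{p\mid r}\frac1p\right]$, the sum being over the primes $p\mid r$. Then: (1) for every positive integer $r\mid\mathbf r$, the element $N'_rx_r\in U_r$ represents a class in $H^0(G,U_r/MU_r)$; its image in $H^0(G,U/MU)$ is the universal Kolyvagin class $c_r$; (2) the universal Kolyvagin classes satisfy the universal Kolyvagin recursion: for every positive integer $r\mid\mathbf r$, the class $c_r$ lies in (the image of) $H^0(G,U_r/MU_r)$,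 and $D_\ell c_r=c_{r/\ell}$ in $H^0(G,U/MU)$ for every prime $\ell\mid r$. -/

import Mathlib

open scoped NumberField

noncomputable section

namespace UniversalKolyvagin

/-- The prime number `p` splits completely in the number field `F`: every prime of `𝓞 F`
above `p` has ramification index one and residue degree one. -/
def SplitsCompletely (F : Type*) [Field F] [NumberField F] (p : ℕ) : Prop :=
  ∀ P : Ideal (𝓞 F), P.IsPrime → P.LiesOver (Ideal.span {(p : ℤ)}) →
    Ideal.ramificationIdx P ℤ = 1 ∧ Ideal.inertiaDeg P ℤ = 1

/-- The odd primes `ℓ ≡ 1 mod M` that split completely in `F`. Their formal product is the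
supernatural number `𝐫`. -/
def IsKPrime (F : Type*) [Field F] [NumberField F] (M : ℕ) (p : ℕ) : Prop :=
  p.Prime ∧ Odd p ∧ p ≡ 1 [MOD M] ∧ SplitsCompletely F p

variable (F : Type*) [Field F] [NumberField F] (M : ℕ)

/-- The type of primes dividing `𝐫`. As `𝐫` is a product of distinct primes, a supernatural
divisor of `𝐫` is the same as a set of such primes: `𝐫` itself is `Set.univ`, and `𝐫 / ℓ`
is `{ℓ}ᶜ`. -/
abbrev KPrime : Type := {p : ℕ // IsKPrime F M p}

/-- The positive integers dividing `𝐫`. -/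
abbrev Divisor : Type :=
  {r : ℕ // Squarefree r ∧ ∀ p : ℕ, p.Prime → p ∣ r → IsKPrime F M p}

variable {F M}

theorem Divisor.ne_zero (r : Divisor F M) : (r : ℕ) ≠ 0 := r.2.1.ne_zero

/-- A divisor of a positive integer dividing `𝐫`. -/
def Divisor.ofDvd (r : Divisor F M) (n : ℕ) (h : n ∣ r) : Divisor F M :=
  ⟨n, r.2.1.squarefree_of_dvd h, fun p hp hpn => r.2.2 p hp (hpn.trans h)⟩

/-- The integer `r / ℓ` for a prime `ℓ` dividing `r`. -/
def Divisor.quot (r : Divisor F M) (l : KPrime F M) (h : (l : ℕ) ∣ r) : Divisor F M :=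
  r.ofDvd (r / l) (Nat.div_dvd_of_dvd h)

/-- The positive integer `r ∣ 𝐫`, regarded as a supernatural divisor of `𝐫`. -/
def Divisor.primes (r : Divisor F M) : Set (KPrime F M) := {l | (l : ℕ) ∣ r}

variable (F M)

/-! ### The field `F(μ_𝐫)` and its Galois group -/

/-- The field `F_𝐫` generated over `F` by all roots of unity of order dividing `𝐫`. -/
abbrev CycField : IntermediateField F (AlgebraicClosure F) :=
  IntermediateField.adjoin F {z | ∃ n : Divisor F M, z ^ (n : ℕ) = 1}

/-- The Galois group of `F_𝐫 / F`. -/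
abbrev G : Type _ := CycField F M ≃ₐ[F] CycField F M

variable {F M}

/-- `σ` generates the inertia subgroup at some place of `F_𝐫` above `ℓ`. -/
def IsInertiaGenerator (l : KPrime F M) (s : G F M) : Prop :=
  ∃ P : Ideal (𝓞 (CycField F M)), P.IsPrime ∧ P.LiesOver (Ideal.span {((l : ℕ) : ℤ)}) ∧
    Subgroup.zpowers s = P.inertia (G F M)

instance : SMulCommClass (G F M) (𝓞 F) (𝓞 (CycField F M)) where
  smul_comm s a x := by
    apply NumberField.RingOfIntegers.ext
    have h1 : ∀ y : 𝓞 (CycField F M), ((s • y : 𝓞 (CycField F M)) : CycField F M) =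
        s (y : CycField F M) := fun y => rfl
    have h2 : ∀ y : 𝓞 (CycField F M), ((a • y : 𝓞 (CycField F M)) : CycField F M) =
        (a : F) • (y : CycField F M) := fun y => by
      rw [Algebra.smul_def, Algebra.smul_def]
      rfl
    rw [h1, h2, h2, h1, Algebra.smul_def, Algebra.smul_def, map_mul, AlgEquiv.commutes]

/-- `φ` is an arithmetic Frobenius automorphism at some place of `F_𝐫` above `ℓ`; such a `φ`
is a representative in `G` of the class `Frob_ℓ ∈ G / G_ℓ`. -/
def IsFrobenius (l : KPrime F M) (f : G F M) : Prop :=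
  ∃ P : Ideal (𝓞 (CycField F M)), P.IsPrime ∧ P.LiesOver (Ideal.span {((l : ℕ) : ℤ)}) ∧
    IsArithFrobAt (𝓞 F) f P

/-! ### The group `(1/𝐬)ℤ/ℤ` and the action of `G` -/

/-- The subgroup `(1/𝐬)ℤ/ℤ` of `ℚ/ℤ`, for `𝐬` a supernatural divisor of `𝐫`: the union of the
groups `(1/n)ℤ/ℤ` (the `n`-torsion of `ℚ/ℤ`) over the positive integers `n ∣ 𝐬`. -/
def Tor (S : Set (KPrime F M)) : AddSubgroup (AddCircle (1 : ℚ)) where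
  carrier := {a | ∃ n : Divisor F M, n.primes ⊆ S ∧ (n : ℕ) • a = 0}
  zero_mem' := by
    refine ⟨⟨1, squarefree_one, fun p hp h => ?_⟩, fun l hl => ?_, by simp⟩
    · exact absurd (Nat.dvd_one.1 h) hp.ne_one
    · exact absurd (Nat.dvd_one.1 hl) l.2.1.ne_one
  neg_mem' := by
    rintro a ⟨n, hn, ha⟩
    exact ⟨n, hn, by rw [smul_neg, ha, neg_zero]⟩
  add_mem' := by
    rintro a b ⟨m, hm, ha⟩ ⟨n, hn, hb⟩
    have key : ∀ p : ℕ, p.Prime → p ∣ Nat.lcm m n → p ∣ (m : ℕ) ∨ p ∣ (n : ℕ) :=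
      fun p hp h => hp.dvd_mul.1 (h.trans (Nat.lcm_dvd_mul _ _))
    refine ⟨⟨Nat.lcm m n, ?_, fun p hp h => ?_⟩, fun l hl => ?_, ?_⟩
    · rw [Nat.squarefree_iff_prime_squarefree]
      intro p hp h
      have h2 : p ^ 2 ∣ Nat.lcm m n := by rwa [pow_two]
      rw [hp.pow_dvd_iff_le_factorization (Nat.lcm_ne_zero m.ne_zero n.ne_zero),
        Nat.factorization_lcm m.ne_zero n.ne_zero, Finsupp.sup_apply] at h2
      have h3 := m.2.1.natFactorization_le_one p
      have h4 := n.2.1.natFactorization_le_one p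
      have h5 := h2.trans (sup_le h3 h4)
      omega
    · exact (key p hp h).elim (m.2.2 p hp) (n.2.2 p hp)
    · exact (key l l.2.1 hl).elim (fun h => hm h) (fun h => hn h)
    · obtain ⟨u, hu⟩ := Nat.dvd_lcm_left (m : ℕ) n
      obtain ⟨v, hv⟩ := Nat.dvd_lcm_right (m : ℕ) n
      have h1 : Nat.lcm m n • a = 0 := by rw [hu, mul_comm, mul_smul, ha, smul_zero]
      have h2 : Nat.lcm m n • b = 0 := by rw [hv, mul_comm, mul_smul, hb, smul_zero]
      change Nat.lcm m n • (a + b) = 0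
      rw [smul_add, h1, h2, add_zero]

theorem Tor_mono {S S' : Set (KPrime F M)} (h : S ⊆ S') : Tor S ≤ Tor S' := by
  rintro a ⟨n, hn, ha⟩
  exact ⟨n, hn.trans h, ha⟩

theorem exists_exponent (s : G F M) (n : ℕ) :
    ∃ m : ℤ, n ≠ 0 → ∀ z : CycField F M, z ^ n = 1 → s z = z ^ m := by
  by_cases hn : n = 0
  · exact ⟨0, fun h => absurd hn h⟩
  have : NeZero n := ⟨hn⟩
  obtain ⟨m, hm⟩ := rootsOfUnity.integer_power_of_ringEquiv' n s.toRingEquiv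
  refine ⟨m, fun _ z hz => ?_⟩
  have := hm (Units.ofPowEqOne z n hz hn) (by
    rw [mem_rootsOfUnity]; exact Units.pow_ofPowEqOne hz hn)
  simpa using this

/-- An integer `m` such that `σ z = z ^ m` for all `n`-th roots of unity `z` in `F_𝐫`. -/
def exponent (s : G F M) (n : ℕ) : ℤ := (exists_exponent s n).choose

theorem exponent_spec (s : G F M) {n : ℕ} (hn : n ≠ 0) {z : CycField F M} (hz : z ^ n = 1) :
    s z = z ^ exponent s n :=
  (exists_exponent s n).choose_spec hn z hz

theorem exists_primitiveRoot (n : Divisor F M) :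
    ∃ z : CycField F M, IsPrimitiveRoot z n := by
  have : NeZero ((n : ℕ) : AlgebraicClosure F) :=
    ⟨by exact_mod_cast n.ne_zero⟩
  obtain ⟨z, hz⟩ := HasEnoughRootsOfUnity.exists_primitiveRoot (AlgebraicClosure F) (n : ℕ)
  exact ⟨⟨z, IntermediateField.subset_adjoin F _ ⟨n, hz.pow_eq_one⟩⟩,
    IsPrimitiveRoot.of_map_of_injective (f := (CycField F M).val) hz Subtype.val_injective⟩

theorem addOrderOf_dvd {S : Set (KPrime F M)} (a : Tor S) :
    ∃ n : Divisor F M, (n : ℕ) = addOrderOf (a : AddCircle (1 : ℚ)) := by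
  obtain ⟨a, n, -, ha⟩ := a
  exact ⟨n.ofDvd _ (addOrderOf_dvd_of_nsmul_eq_zero ha), rfl⟩

/-- `G` acts on `(1/𝐬)ℤ/ℤ` through its action on roots of unity: if `a` has order `n` and
`σ z = z ^ m` for the `n`-th roots of unity `z`, then `σ` sends `a` to `m a`. -/
instance (S : Set (KPrime F M)) : SMul (G F M) (Tor S) where
  smul s a := exponent s (addOrderOf (a : AddCircle (1 : ℚ))) • a

theorem smul_eq {S : Set (KPrime F M)} (s : G F M) (a : Tor S) {n : ℕ} (hn : n ≠ 0)
    (ha : n • a = 0) {m : ℤ} (hm : ∀ z : CycField F M, z ^ n = 1 → s z = z ^ m) :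
    s • a = m • a := by
  obtain ⟨k, hk⟩ := addOrderOf_dvd a
  obtain ⟨z, hz⟩ := exists_primitiveRoot k
  have hkn : (k : ℕ) ∣ n := by
    rw [hk]
    exact addOrderOf_dvd_of_nsmul_eq_zero (congrArg Subtype.val ha)
  have h1 : s z = z ^ exponent s k := exponent_spec s k.ne_zero hz.pow_eq_one
  have h2 : s z = z ^ m := by
    refine hm z ?_
    obtain ⟨c, rfl⟩ := hkn
    rw [pow_mul, hz.pow_eq_one, one_pow]
  have hz0 : z ≠ 0 := hz.ne_zero k.ne_zero
  have h3 : z ^ (exponent s k - m) = 1 := by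
    rw [zpow_sub₀ hz0, ← h1, h2, div_self (zpow_ne_zero _ hz0)]
  rw [hz.zpow_eq_one_iff_dvd] at h3
  change exponent s (addOrderOf (a : AddCircle (1 : ℚ))) • a = m • a
  rw [← hk, ← sub_eq_zero, ← sub_smul]
  obtain ⟨c, hc⟩ := h3
  rw [hc, mul_comm, mul_smul, natCast_zsmul, hk, AddSubgroup.addOrderOf_coe,
    addOrderOf_nsmul_eq_zero, smul_zero]

theorem exists_nsmul {S : Set (KPrime F M)} (a : Tor S) : ∃ n : ℕ, n ≠ 0 ∧ n • a = 0 := by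
  obtain ⟨a, n, hn, ha⟩ := a
  exact ⟨n, n.ne_zero, Subtype.ext ha⟩

instance (S : Set (KPrime F M)) : DistribMulAction (G F M) (Tor S) where
  one_smul a := by
    obtain ⟨n, hn, ha⟩ := exists_nsmul a
    rw [smul_eq 1 a hn ha (m := 1) (by simp), one_smul]
  mul_smul s t a := by
    obtain ⟨n, hn, ha⟩ := exists_nsmul a
    have hs := fun z hz => exponent_spec s hn (z := z) hz
    have ht := fun z hz => exponent_spec t hn (z := z) hz
    rw [smul_eq t a hn ha ht, smul_eq s _ hn (by rw [smul_comm, ha, smul_zero]) hs,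
      smul_eq (s * t) a hn ha (m := exponent s n * exponent t n) ?_, mul_smul]
    intro z hz
    rw [AlgEquiv.mul_apply, ht z hz, map_zpow₀, hs z hz, zpow_mul]
  smul_zero s := by
    change exponent s _ • (0 : Tor S) = 0
    rw [smul_zero]
  smul_add s a b := by
    obtain ⟨m, hm, ha⟩ := exists_nsmul a
    obtain ⟨n, hn, hb⟩ := exists_nsmul b
    have hmn := mul_ne_zero hm hn
    have ha' : (m * n) • a = 0 := by rw [mul_comm, mul_smul, ha, smul_zero]
    have hb' : (m * n) • b = 0 := by rw [mul_smul, hb, smul_zero]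
    have hs := fun z hz => exponent_spec s hmn (z := z) hz
    rw [smul_eq s a hmn ha' hs, smul_eq s b hmn hb' hs,
      smul_eq s (a + b) hmn (by rw [smul_add, ha', hb', add_zero]) hs, smul_add]

/-- The action is the one determined by the action of `G` on roots of unity, for any injective
homomorphism from `(1/𝐬)ℤ/ℤ` to the multiplicative group of `F_𝐫`. -/
theorem smul_eq_iff {S : Set (KPrime F M)} (f : Multiplicative (Tor S) →* (CycField F M)ˣ)
    (hf : Function.Injective f) (s : G F M) (a b : Tor S) :
    s • a = b ↔
      s (f (Multiplicative.ofAdd a) : CycField F M) = (f (Multiplicative.ofAdd b) : CycField F M) := by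
  obtain ⟨n, hn, ha⟩ := exists_nsmul a
  have h0 : (f (Multiplicative.ofAdd a) : CycField F M) ^ n = 1 := by
    rw [← Units.val_pow_eq_pow_val, ← map_pow, ← ofAdd_nsmul, ha]
    simp
  have key : s (f (Multiplicative.ofAdd a) : CycField F M) =
      (f (Multiplicative.ofAdd (s • a)) : CycField F M) := by
    rw [smul_eq s a hn ha (fun z hz => exponent_spec s hn hz), ofAdd_zsmul, map_zpow,
      Units.val_zpow_eq_zpow_val]
    exact exponent_spec s hn h0
  rw [key, Units.val_inj, hf.eq_iff, Multiplicative.ofAdd.injective.eq_iff]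

theorem smul_mem_iff {S S' : Set (KPrime F M)} (s : G F M) (a : Tor S)
    (ha : (a : AddCircle (1 : ℚ)) ∈ Tor S') : ((s • a : Tor S) : AddCircle (1 : ℚ)) ∈ Tor S' :=
  (Tor S').zsmul_mem ha _

theorem coe_smul_incl {S S' : Set (KPrime F M)} (h : S ⊆ S') (s : G F M) (a : Tor S) :
    AddSubgroup.inclusion (Tor_mono h) (s • a) = s • AddSubgroup.inclusion (Tor_mono h) a := rfl

/-! ### The groups `𝒜(𝐬)`, `U_𝐬`, `U_𝐬/MU_𝐬` and their invariants -/

/-- The free abelian group `𝒜(𝐬)` on the symbols `[a]`, `a ∈ (1/𝐬)ℤ/ℤ`. -/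
abbrev A (S : Set (KPrime F M)) : Type := Tor S →₀ ℤ

/-- The symbol `[a]`. -/
def sym {S : Set (KPrime F M)} (a : Tor S) : A S := Finsupp.single a 1

/-- The action of `G` on `𝒜(𝐬)`, with `σ [a] = [σ a]`. -/
def repA (S : Set (KPrime F M)) : Representation ℤ (G F M) (A S) where
  toFun s := Finsupp.lmapDomain ℤ ℤ (fun a => s • a)
  map_one' := by ext a; simp
  map_mul' s t := by ext a; simp [mul_smul]

theorem repA_sym {S : Set (KPrime F M)} (s : G F M) (a : Tor S) :
    repA S s (sym a) = sym (s • a) := by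
  simp [repA, sym]

/-- `z` is one of the elements `[a] - ∑_{ℓ b = a} [b]`, where `ℓ ∣ 𝐬` is a prime and
`a ∈ (ℓ/𝐬)ℤ/ℤ`. -/
def IsRelation (S : Set (KPrime F M)) (z : A S) : Prop :=
  ∃ l ∈ S, ∃ a : Tor S, (a : AddCircle (1 : ℚ)) ∈ Tor (S \ {l}) ∧
    ∃ B : Finset (Tor S), (∀ b, b ∈ B ↔ (l : ℕ) • b = a) ∧ z = sym a - ∑ b ∈ B, sym b

/-- The subgroup generated by the distribution relations. -/
def relations (S : Set (KPrime F M)) : Submodule ℤ (A S) := Submodule.span ℤ {z | IsRelation S z}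

theorem relations_le_comap (S : Set (KPrime F M)) (s : G F M) :
    relations S ≤ (relations S).comap (repA S s) := by
  classical
  refine Submodule.span_le.2 ?_
  rintro _ ⟨l, hl, a, ha, B, hB, rfl⟩
  refine Submodule.subset_span ⟨l, hl, s • a, smul_mem_iff s a ha,
    B.image (fun b => s • b), fun b => ?_, ?_⟩
  · rw [Finset.mem_image]
    constructor
    · rintro ⟨b, hb, rfl⟩
      rw [← (hB b).1 hb, smul_comm]
    · intro hb
      refine ⟨s⁻¹ • b, (hB _).2 ?_, smul_inv_smul s b⟩
      rw [smul_comm, hb, inv_smul_smul]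
  · rw [map_sub, map_sum, repA_sym,
      Finset.sum_image (fun x _ y _ h => MulAction.injective s h)]
    simp only [repA_sym]

/-- The universal ordinary distribution `U_𝐬` of level `𝐬`. -/
abbrev U (S : Set (KPrime F M)) : Type := A S ⧸ relations S

/-- The action of `G` on `U_𝐬`. -/
def repU (S : Set (KPrime F M)) : Representation ℤ (G F M) (U S) :=
  (repA S).quotient (relations S) (relations_le_comap S)

/-- The subgroup `M U_𝐬` of `U_𝐬`. -/
def multiples (S : Set (KPrime F M)) : Submodule ℤ (U S) :=
  LinearMap.range ((M : ℤ) • (LinearMap.id : U S →ₗ[ℤ] U S))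

theorem multiples_le_comap (S : Set (KPrime F M)) (s : G F M) :
    multiples S ≤ (multiples S).comap (repU S s) := by
  rintro _ ⟨x, rfl⟩
  exact ⟨repU S s x, by simp⟩

/-- The quotient `U_𝐬 / M U_𝐬`. -/
abbrev UM (S : Set (KPrime F M)) : Type := U S ⧸ multiples S

/-- The action of `G` on `U_𝐬 / M U_𝐬`. -/
def repUM (S : Set (KPrime F M)) : Representation ℤ (G F M) (UM S) :=
  (repU S).quotient (multiples S) (multiples_le_comap S)

/-- The group `H⁰(G, U_𝐬 / M U_𝐬)`. -/
abbrev H0 (S : Set (KPrime F M)) : Submodule ℤ (UM S) := (repUM S).invariants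

theorem relations_le_incl {S S' : Set (KPrime F M)} (h : S ⊆ S') :
    relations S ≤ (relations S').comap
      (Finsupp.lmapDomain ℤ ℤ (AddSubgroup.inclusion (Tor_mono h))) := by
  classical
  refine Submodule.span_le.2 ?_
  rintro _ ⟨l, hl, a, ha, B, hB, rfl⟩
  refine Submodule.subset_span ⟨l, h hl, AddSubgroup.inclusion (Tor_mono h) a,
    Tor_mono (Set.sdiff_subset_sdiff_left h) ha,
    B.image (AddSubgroup.inclusion (Tor_mono h)), fun b => ?_, ?_⟩
  · rw [Finset.mem_image]
    constructor
    · rintro ⟨b, hb, rfl⟩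
      rw [← (hB b).1 hb, map_nsmul]
    · intro hb
      have hb' : (l : ℕ) • (b : AddCircle (1 : ℚ)) = a := congrArg Subtype.val hb
      obtain ⟨n, hn, hna⟩ := ha
      have hln : ¬ (l : ℕ) ∣ n := fun hd => (hn hd).2 rfl
      have hbS : (b : AddCircle (1 : ℚ)) ∈ Tor S := by
        refine ⟨⟨n * l, ?_, fun p hp hd => ?_⟩, fun q hq => ?_, ?_⟩
        · exact (Nat.squarefree_mul ((l.2.1.coprime_iff_not_dvd.2 hln).symm)).2
            ⟨n.2.1, l.2.1.prime.squarefree⟩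
        · rcases hp.dvd_mul.1 hd with h1 | h1
          · exact n.2.2 p hp h1
          · rw [(Nat.prime_dvd_prime_iff_eq hp l.2.1).1 h1]
            exact l.2
        · rcases q.2.1.dvd_mul.1 hq with h1 | h1
          · exact (hn h1).1
          · rw [show q = l from Subtype.ext ((Nat.prime_dvd_prime_iff_eq q.2.1 l.2.1).1 h1)]
            exact hl
        · change ((n : ℕ) * (l : ℕ)) • (b : AddCircle (1 : ℚ)) = 0
          rw [mul_smul, hb', hna]
      exact ⟨⟨b, hbS⟩, (hB _).2 (Subtype.ext hb'), rfl⟩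
  · rw [map_sub, map_sum, Finset.sum_image
      (fun x _ y _ hxy => AddSubgroup.inclusion_injective (Tor_mono h) hxy)]
    simp [sym]

/-- The map `U_𝐬 → U_𝐬'` induced by the inclusion `𝒜(𝐬) ⊆ 𝒜(𝐬')`, for `𝐬 ∣ 𝐬'`. -/
def incl {S S' : Set (KPrime F M)} (h : S ⊆ S') : U S →ₗ[ℤ] U S' :=
  Submodule.mapQ _ _ _ (relations_le_incl h)

/-- The map `U_𝐬 / M U_𝐬 → U_𝐬' / M U_𝐬'` induced by `U_𝐬 → U_𝐬'`, for `𝐬 ∣ 𝐬'`. -/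
def inclM {S S' : Set (KPrime F M)} (h : S ⊆ S') : UM S →ₗ[ℤ] UM S' :=
  Submodule.mapQ _ _ (incl h) (by rintro _ ⟨x, rfl⟩; exact ⟨incl h x, by simp⟩)

/-- The class in `U_𝐬 / M U_𝐬` of an element of `U_𝐬`. -/
abbrev red {S : Set (KPrime F M)} (x : U S) : UM S := Submodule.Quotient.mk x

/-! ### The subgroup `I_ℓ` and the operator `D_ℓ` -/

/-- The subgroup `I_ℓ` of `U = U_𝐫` generated by the classes of `[a] - [b]` with
`a - b ∈ (1/ℓ)ℤ/ℤ`. -/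
def I (l : KPrime F M) : Submodule ℤ (U (Set.univ : Set (KPrime F M))) :=
  Submodule.span ℤ {z | ∃ a b : Tor (Set.univ : Set (KPrime F M)),
    (l : ℕ) • (a - b) = 0 ∧ z = Submodule.Quotient.mk (sym a - sym b)}

/-- The characterizing property of the operator
`D_ℓ : H⁰(G, U/MU) → H⁰(G, U_{𝐫/ℓ}/MU_{𝐫/ℓ})`, where `s` stands for the generator `σ_ℓ` and
`f` for `Frob_ℓ`: for `x ∈ U` and `y ∈ U_{𝐫/ℓ}` representing invariant classes,
`(σ_ℓ - 1)x / M ≡ (ℓ - Frob_ℓ)y / M mod I_ℓ` if and only if `D_ℓ` maps the class of `x` to the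
class of `y`. The quotients by `M` are the elements `u`, `v` with `M u = (σ_ℓ - 1)x` and
`M v = (ℓ - Frob_ℓ)y`. -/
def IsDOperator (l : KPrime F M) (s f : G F M)
    (D : H0 (Set.univ : Set (KPrime F M)) →ₗ[ℤ] H0 ({l}ᶜ : Set (KPrime F M))) : Prop :=
  ∀ (x : U (Set.univ : Set (KPrime F M))) (y : U ({l}ᶜ : Set (KPrime F M)))
    (hx : red x ∈ H0 (Set.univ : Set (KPrime F M)))
    (hy : red y ∈ H0 ({l}ᶜ : Set (KPrime F M))),
    (∃ (u : U (Set.univ : Set (KPrime F M))) (v : U ({l}ᶜ : Set (KPrime F M))),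
        (M : ℤ) • u = repU _ s x - x ∧
        (M : ℤ) • v = ((l : ℕ) : ℤ) • y - repU _ f y ∧
        u - incl (Set.subset_univ _) v ∈ I l) ↔
      D ⟨red x, hx⟩ = ⟨red y, hy⟩

/-- The universal Kolyvagin recursion for a family of classes `c_r ∈ H⁰(G, U/MU)` indexed by the
positive integers `r ∣ 𝐫`, relative to the operators `D_ℓ`: the class `c_r` comes from
`H⁰(G, U_r/MU_r)`, and `D_ℓ c_r = c_{r/ℓ}` (in `H⁰(G, U/MU)`) for all primes `ℓ ∣ r`. -/
def SatisfiesRecursion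
    (D : ∀ l : KPrime F M,
      H0 (Set.univ : Set (KPrime F M)) →ₗ[ℤ] H0 ({l}ᶜ : Set (KPrime F M)))
    (c : Divisor F M → H0 (Set.univ : Set (KPrime F M))) : Prop :=
  ∀ r : Divisor F M,
    (∃ d ∈ H0 r.primes, inclM (Set.subset_univ _) d = (c r : UM Set.univ)) ∧
    ∀ (l : KPrime F M) (h : (l : ℕ) ∣ r),
      inclM (Set.subset_univ _) (D l (c r) : UM ({l}ᶜ : Set (KPrime F M))) =
        (c (r.quot l h) : UM Set.univ)

/-! ### The universal Euler system and the universal Kolyvagin classes -/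

theorem sum_inv_mem (r : Divisor F M) :
    ∑ p ∈ (r : ℕ).primeFactors, ((1 / (p : ℚ) : ℚ) : AddCircle (1 : ℚ)) ∈ Tor r.primes := by
  refine AddSubgroup.sum_mem _ fun p hp => ⟨r, subset_rfl, ?_⟩
  obtain ⟨c, hc⟩ := Nat.dvd_of_mem_primeFactors hp
  have hp0 : (p : ℚ) ≠ 0 := by exact_mod_cast (Nat.prime_of_mem_primeFactors hp).ne_zero
  rw [← AddCircle.coe_nsmul, AddCircle.coe_eq_zero_iff]
  refine ⟨c, ?_⟩
  rw [hc]
  simp only [zsmul_eq_mul, nsmul_eq_mul, Int.cast_natCast, Nat.cast_mul, mul_one]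
  field_simp

/-- The element `x_r ∈ U_r`, the class of the symbol `[∑_{p ∣ r} 1/p]`. -/
def xElt (r : Divisor F M) : U r.primes :=
  Submodule.Quotient.mk
    (sym ⟨∑ p ∈ (r : ℕ).primeFactors, ((1 / (p : ℚ) : ℚ) : AddCircle (1 : ℚ)), sum_inv_mem r⟩)

/-- The element `N'_ℓ = ∑_{i = 1}^{ℓ - 2} i σ_ℓ^i` of the group ring `ℤ[G]`. -/
def derivPrime (l : ℕ) (s : G F M) : MonoidAlgebra ℤ (G F M) :=
  ∑ i ∈ Finset.Icc 1 (l - 2), (i : ℤ) • MonoidAlgebra.of ℤ (G F M) (s ^ i)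

/-- The element `N'_r = ∏_{ℓ ∣ r} N'_ℓ` of the group ring `ℤ[G]`. The group `G` is abelian, so the
order of the factors is irrelevant; they are multiplied in increasing order of `ℓ`. -/
def deriv (s : KPrime F M → G F M) (r : Divisor F M) : MonoidAlgebra ℤ (G F M) :=
  ((r : ℕ).primeFactorsList.attach.map fun p =>
    derivPrime p.1 (s ⟨p.1, r.2.2 p.1 (Nat.prime_of_mem_primeFactorsList p.2)
      (Nat.dvd_of_mem_primeFactorsList p.2)⟩)).prod

/-- The element `N'_r x_r` of `U_r`, which represents the universal Kolyvagin class `c_r`. -/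
def kolyvaginElt (s : KPrime F M → G F M) (r : Divisor F M) : U r.primes :=
  (repU r.primes).asAlgebraHom (deriv s r) (xElt r)

end UniversalKolyvagin

end

/-!
The elements `x_r = [∑_{p ∣ r} 1/p]` form an Euler system, and the proof is Kolyvagin's derivative
argument for it, carried out in the torsion-free groups `U_𝐬`.

*Galois action.* A prime `ℓ ∣ 𝐫` splits completely in `F`. Therefore the inertia group at `ℓ` acts
trivially on `(1/(𝐫/ℓ))ℤ/ℤ` (`IsInertiaGenerator.smul_eq_self`) and through all of `(ℤ/ℓ)ˣ` on
`(1/ℓ)ℤ/ℤ` (`IsInertiaGenerator.mem_zpowers_torsionChar`), while `Frob_ℓ` acts on `(1/(𝐫/ℓ))ℤ/ℤ` as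
multiplication by `ℓ` (`IsFrobenius.smul_eq`). For `b` of order prime to `ℓ`, the distribution
relation at `ℓ` then becomes the norm relation `∑_i σ_ℓ ^ i [b + 1/ℓ] = (Frob_ℓ - 1) [b]`
(`sum_repU_pow_symU`).

*Invariance.* Since `(σ_ℓ - 1) N'_ℓ = (ℓ - 1) - ∑_i σ_ℓ ^ i`, one finds
`(σ_ℓ - 1) N'_r x_r = (ℓ - 1) N'_{r/ℓ} x_r - (Frob_ℓ - 1) N'_{r/ℓ} x_{r/ℓ}`
(`repU_kolyvaginElt_sub`). As `M ∣ ℓ - 1` and `G` acts on `U_r` through the `σ_ℓ` with `ℓ ∣ r`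
(`exists_repU_eq`), the class of `N'_r x_r` is invariant by induction on `r`
(`kolyvaginElt_invariant`).

*Torsion-freeness.* The relation at `ℓ`, solved for `[b + 1/ℓ]`, is a rewriting rule. These rules
terminate (`rewriteElt_support`) and are locally confluent (`rewriteElt_sub_rewriteElt_mem`), so
that `U_𝐬` embeds in a free abelian group (`exists_normalForm`, `smul_eq_zero_U`).

*The operator `D_ℓ`.* The map `[a] ↦ [ℓ a]` shows that an element of `U_{𝐫/ℓ}` lies in `I_ℓ` exactly
if it is in the image of `ℓ - Frob_ℓ` (`incl_eulerFactor_mem_I`, `mem_range_eulerFactor`), and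
`ℓ - Frob_ℓ` is injective because `Frob_ℓ` has finite orbits and `U_{𝐫/ℓ}` has no torsion
(`eulerFactor_injective`). Together with `U = U_{𝐫/ℓ} + I_ℓ`, this makes the relation
`(σ_ℓ - 1) x / M ≡ (ℓ - Frob_ℓ) y / M mod I_ℓ` the graph of a homomorphism
(`exists_isDOperator`). Dividing the formula for `(σ_ℓ - 1) N'_r x_r` by `M` gives the recursion
(`DRelation_kolyvaginElt`), as `x_r - x_{r/ℓ} ∈ I_ℓ`.
-/

noncomputable section

namespace UniversalKolyvagin

open scoped Pointwise

/-! ### Inertia groups in algebraic extensions -/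

theorem isInvariant_ringOfIntegers (L K : Type*) [Field L] [Field K] [Algebra L K] [IsGalois L K] :
    Algebra.IsInvariant (𝓞 L) (𝓞 K) (K ≃ₐ[L] K) where
  isInvariant b hb := by
    have h1 : ∀ g : K ≃ₐ[L] K, g (b : K) = b := fun g =>
      congrArg (fun y : 𝓞 K => (y : K)) (hb g)
    obtain ⟨a, ha⟩ := (InfiniteGalois.mem_bot_iff_fixed (k := L) (b : K)).2 h1
    have ha' : algebraMap L K a = b := ha
    have hint : IsIntegral ℤ a := by
      rw [← isIntegral_algebraMap_iff (algebraMap L K).injective, ha']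
      exact b.2
    exact ⟨⟨a, hint⟩, NumberField.RingOfIntegers.ext ha'⟩

instance smulCommClass_ringOfIntegers (L K : Type*) [Field L] [Field K] [Algebra L K] :
    SMulCommClass (K ≃ₐ[L] K) (𝓞 L) (𝓞 K) where
  smul_comm s a x := by
    apply NumberField.RingOfIntegers.ext
    rw [Algebra.smul_def, Algebra.smul_def]
    change s (algebraMap L K a * x) = algebraMap L K a * s x
    rw [map_mul, AlgEquiv.commutes]

/-- Elements of the inertia group lift from an intermediate field `L` to `K`: if `t` acts trivially
on `𝓞 L` modulo `P`, then some element of the inertia group of `P` agrees with `t` on `L`. As `K`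
may be infinite over `L`, this uses the transitivity of the profinite group `Gal(K/L)` on the
primes above `P ∩ 𝓞 L`, and the surjectivity of the decomposition group onto the residual
automorphisms. -/
theorem exists_mul_mem_inertia {F K : Type*} [Field F] [Field K] [Algebra F K]
    (L : IntermediateField F K) [IsGalois L K] (P : Ideal (𝓞 K)) [P.IsPrime]
    (t : K ≃ₐ[F] K)
    (ht : ∀ x : 𝓞 L, t • algebraMap (𝓞 L) (𝓞 K) x - algebraMap (𝓞 L) (𝓞 K) x ∈ P) :
    ∃ g : K ≃ₐ[L] K, t * g.restrictScalars F ∈ P.inertia (K ≃ₐ[F] K) := by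
  -- The profinite theorems are about continuous actions on discrete rings.
  let _ : TopologicalSpace (𝓞 K) := ⊥
  have : DiscreteTopology (𝓞 K) := ⟨rfl⟩
  have := isInvariant_ringOfIntegers L K
  have : ContinuousSMul (K ≃ₐ[L] K) (𝓞 K) := by
    rw [continuousSMul_iff_stabilizer_isOpen]
    intro b
    convert! stabilizer_isOpen_of_isIntegral (K := L) (b : K) using 1
    ext g
    exact NumberField.RingOfIntegers.ext_iff
  have hunder : P.under (𝓞 L) = (t⁻¹ • P).under (𝓞 L) := by
    ext x
    rw [Ideal.mem_comap, Ideal.mem_comap, Ideal.mem_inv_pointwise_smul_iff]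
    exact ⟨fun h => by simpa using P.add_mem (ht x) h, fun h => by
      simpa using P.sub_mem h (ht x)⟩
  -- Correct `t` by an element of `Gal(K/L)` so as to make it stabilize `P`.
  obtain ⟨g, hg⟩ := Algebra.IsInvariant.exists_smul_of_under_eq_of_profinite
    (A := 𝓞 L) (G := K ≃ₐ[L] K) P (t⁻¹ • P) hunder
  have hcomp : ∀ (h : K ≃ₐ[L] K) (x : 𝓞 K), (t * h.restrictScalars F) • x = t • h • x :=
    fun h x => rfl
  set t₁ := t * g.restrictScalars F with ht₁
  have hstab : ∀ x, t₁ • x ∈ P ↔ x ∈ P := by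
    intro x
    rw [hcomp, ← Ideal.mem_inv_pointwise_smul_iff, hg, Ideal.smul_mem_pointwise_smul_iff]
  have hmap : P = P.map (MulSemiringAction.toRingEquiv _ (𝓞 K) t₁ : 𝓞 K →+* 𝓞 K) := by
    ext x
    rw [Ideal.map_comap_of_equiv, Ideal.mem_comap]
    change x ∈ P ↔ t₁⁻¹ • x ∈ P
    rw [← hstab (t₁⁻¹ • x), smul_inv_smul]
  have hq : ∀ x : 𝓞 L ⧸ P.under (𝓞 L), Ideal.quotientEquiv P P _ hmap
      (algebraMap _ (𝓞 K ⧸ P) x) = algebraMap _ (𝓞 K ⧸ P) x := by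
    intro x
    obtain ⟨x, rfl⟩ := Ideal.Quotient.mk_surjective x
    refine Ideal.Quotient.eq.2 ?_
    have hg1 : g • algebraMap (𝓞 L) (𝓞 K) x = algebraMap (𝓞 L) (𝓞 K) x := smul_algebraMap g x
    have := ht x
    change t₁ • algebraMap (𝓞 L) (𝓞 K) x - _ ∈ P
    rwa [hcomp, hg1]
  -- The residual automorphism of the corrected element is the identity on `𝓞 L / (P ∩ 𝓞 L)`, so it
  -- comes from a second element of `Gal(K/L)`.
  obtain ⟨⟨h, hh⟩, hh'⟩ := Ideal.Quotient.stabilizerHom_surjective_of_profinite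
    (G := K ≃ₐ[L] K) (P.under (𝓞 L)) P (AlgEquiv.ofRingEquiv hq)
  refine ⟨g * h⁻¹, fun x => ?_⟩
  have := DFunLike.congr_fun hh' (Ideal.Quotient.mk P (h⁻¹ • x))
  have h2 : t₁ • h⁻¹ • x - h • h⁻¹ • x ∈ P := by
    rw [← neg_mem_iff, neg_sub]
    exact Ideal.Quotient.eq.1 this
  rwa [smul_inv_smul] at h2

open IntermediateField in
instance isGalois_cycField (F : Type*) [Field F] [NumberField F] (M : ℕ) :
    IsGalois F (CycField F M) := by
  have : Normal F (CycField F M) := by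
    rw [normal_iff_forall_map_le]
    intro σ
    rw [adjoin_map, adjoin_le_iff]
    rintro _ ⟨z, ⟨n, hz⟩, rfl⟩
    exact subset_adjoin F _ ⟨n, by rw [← map_pow, hz, map_one]⟩
  exact ⟨⟩

/-- If `p` is unramified in `F` at the place below `P`, then `F(μ_p)/F` is totally ramified at `P`
of degree `p - 1`: the ramification index of `P` over `ℚ` is at least that of `ℚ(μ_p)`, which is
`p - 1`, while the Galois group embeds in `(ℤ/p)ˣ`. -/
theorem inertia_eq_top_of_isCyclotomicExtension {F L : Type*} [Field F] [NumberField F] [Field L]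
    [NumberField L] [Algebra F L] {p : ℕ} [Fact p.Prime] [IsCyclotomicExtension {p} F L]
    (P : Ideal (𝓞 L)) [P.IsPrime] [P.LiesOver (Ideal.span {(p : ℤ)})]
    (h : Ideal.ramificationIdx (P.under (𝓞 F)) ℤ = 1) :
    P.inertia (L ≃ₐ[F] L) = ⊤ ∧ Nat.card (L ≃ₐ[F] L) = p - 1 := by
  have : IsGalois F L := IsCyclotomicExtension.isGalois {p} F L
  obtain ⟨z, hz⟩ := IsCyclotomicExtension.exists_isPrimitiveRoot (A := F) (B := L) (S := {p})
    (Set.mem_singleton p) (Fact.out : p.Prime).ne_zero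
  have hcard : Nat.card (L ≃ₐ[F] L) ≤ p - 1 := by
    have := Nat.card_le_card_of_injective _ (hz.autToPow_injective (K := F))
    rwa [Nat.card_eq_fintype_card (α := (ZMod p)ˣ), ZMod.card_units] at this
  let E : IntermediateField ℚ L := IntermediateField.adjoin ℚ {z}
  have : IsCyclotomicExtension {p} ℚ E :=
    hz.intermediateField_adjoin_isCyclotomicExtension ℚ
  have : (P.under (𝓞 E)).LiesOver (Ideal.span {(p : ℤ)}) := inferInstance
  have h1 : Ideal.ramificationIdx (P.under (𝓞 E)) ℤ = p - 1 :=
    IsCyclotomicExtension.Rat.ramificationIdx_eq_of_prime p E (P.under (𝓞 E))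
  have h2 : Ideal.ramificationIdx (P.under (𝓞 E)) ℤ ≤ Ideal.ramificationIdx P ℤ :=
    Ideal.ramificationIdx_below_le _ _
  have h3 : Ideal.ramificationIdx P ℤ = Ideal.ramificationIdx P (𝓞 F) := by
    rw [Ideal.ramificationIdx_tower (R := ℤ) (P.under (𝓞 F)) P, h, one_mul]
  have h4 : Nat.card (P.inertia (L ≃ₐ[F] L)) = Ideal.ramificationIdx P (𝓞 F) := by
    rw [Ideal.card_inertia_eq_ramificationIdxIn (P.under (𝓞 F)) P,
      Ideal.ramificationIdxIn_eq_ramificationIdx (P.under (𝓞 F)) P (L ≃ₐ[F] L)]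
  have h5 : Nat.card (P.inertia (L ≃ₐ[F] L)) ≤ Nat.card (L ≃ₐ[F] L) := Subgroup.card_le_card_group _
  refine ⟨Subgroup.eq_top_of_card_eq _ (by omega), by omega⟩

/-- If `p` is unramified in `F` at the place below `P`, the inertia group of `P` surjects onto
`Gal(F(μ_p)/F) = (ℤ/p)ˣ`. -/
theorem exists_mem_inertia_eq_pow {F K : Type*} [Field F] [NumberField F] [Field K] [Algebra F K]
    [IsGalois F K] {p : ℕ} [Fact p.Prime] (P : Ideal (𝓞 K)) [P.IsPrime]
    [P.LiesOver (Ideal.span {(p : ℤ)})] (h : Ideal.ramificationIdx (P.under (𝓞 F)) ℤ = 1)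
    {z : K} (hz : IsPrimitiveRoot z p) {m : ℕ} (hm : m.Coprime p) :
    ∃ g ∈ P.inertia (K ≃ₐ[F] K), g z = z ^ m := by
  let L : IntermediateField F K := IntermediateField.adjoin F {z}
  have hL : IsCyclotomicExtension {p} F L :=
    hz.intermediateField_adjoin_isCyclotomicExtension F
  have : NumberField L := IsCyclotomicExtension.numberField {p} F L
  have : IsGalois F L := IsCyclotomicExtension.isGalois {p} F L
  let z' : L := ⟨z, IntermediateField.mem_adjoin_simple_self F z⟩
  have hz' : IsPrimitiveRoot z' p :=
    IsPrimitiveRoot.of_map_of_injective (f := L.val) hz Subtype.val_injective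
  have : (P.under (𝓞 L)).LiesOver (Ideal.span {(p : ℤ)}) := inferInstance
  obtain ⟨htop, hcard⟩ := inertia_eq_top_of_isCyclotomicExtension (F := F) (p := p)
    (P.under (𝓞 L)) (by rwa [Ideal.under_under])
  have hbij : Function.Bijective (hz'.autToPow F) := by
    rw [Fintype.bijective_iff_injective_and_card]
    refine ⟨hz'.autToPow_injective (K := F), ?_⟩
    rw [ZMod.card_units, ← hcard, Nat.card_eq_fintype_card]
  obtain ⟨t, ht⟩ := hbij.2 (ZMod.unitOfCoprime m hm)
  have htz : t z' = z' ^ m := by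
    rw [← hz'.autToPow_spec F t, ht, ZMod.coe_unitOfCoprime, ZMod.val_natCast,
      ← pow_mod_orderOf, ← hz'.eq_orderOf, Nat.mod_mod, hz'.eq_orderOf, pow_mod_orderOf]
  obtain ⟨t', ht'⟩ := AlgEquiv.restrictNormalHom_surjective (F := F) (K₁ := L) K t
  have ht2 : ∀ x : L, t' (x : K) = (t x : K) := fun x => by
    rw [← ht']; exact (AlgEquiv.restrictNormal_commutes t' L x).symm
  obtain ⟨g, hg⟩ := exists_mul_mem_inertia L P t' (fun x => by
    have h1 : t ∈ (P.under (𝓞 L)).inertia (L ≃ₐ[F] L) := htop ▸ Subgroup.mem_top t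
    have h2 := h1 x
    have h3 : algebraMap (𝓞 L) (𝓞 K) (t • x - x) ∈ P := h2
    rw [map_sub] at h3
    convert! h3 using 2
    exact NumberField.RingOfIntegers.ext (ht2 x))
  refine ⟨_, hg, ?_⟩
  have h4 : g z = z := g.commutes z'
  calc t' (g z) = t' (z' : K) := by rw [h4]
    _ = z ^ m := by rw [ht2, htz]; rfl

/-- A root of unity of order prime to `P` is determined by its residue class. -/
theorem eq_of_pow_eq_one_of_sub_mem {R : Type*} [CommRing R] [IsDomain R] {P : Ideal R}
    [P.IsPrime] {n : ℕ} (hn : (n : R) ∉ P) {x y : R} (hx : x ^ n = 1) (hy : y ^ n = 1)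
    (h : x - y ∈ P) : x = y := by
  by_contra hne
  have h1 := (Commute.all x y).geom_sum₂_mul n
  rw [hx, hy, sub_self, mul_eq_zero, or_iff_left (sub_ne_zero.2 hne)] at h1
  have hn0 : n ≠ 0 := by rintro rfl; simp at hn
  have h2 : (n : R) * y ^ (n - 1) ∈ P := by
    rw [← Ideal.Quotient.eq] at h
    rw [← Ideal.Quotient.eq_zero_iff_mem]
    have h3 := congrArg (Ideal.Quotient.mk P) h1
    simp only [map_sum, map_mul, map_pow, h, map_zero] at h3
    rw [← h3, map_mul, map_natCast, map_pow]
    rw [Finset.sum_congr rfl (g := fun _ => Ideal.Quotient.mk P y ^ (n - 1))]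
    · simp
    · intro i hi
      rw [← pow_add]
      congr 1
      have := Finset.mem_range.1 hi
      omega
  rcases (inferInstance : P.IsPrime).mem_or_mem h2 with h3 | h3
  · exact hn h3
  · refine (inferInstance : P.IsPrime).ne_top (Ideal.eq_top_of_isUnit_mem _ h3 ?_)
    exact (IsUnit.of_pow_eq_one hy hn0).pow _

/-! ### The groups `(1/𝐬)ℤ/ℤ` -/

variable {F : Type*} [Field F] [NumberField F] {M : ℕ}

theorem Tor_inter (S S' : Set (KPrime F M)) : Tor (S ∩ S') = Tor S ⊓ Tor S' := by
  refine le_antisymm (le_inf (Tor_mono Set.inter_subset_left) (Tor_mono Set.inter_subset_right)) ?_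
  rintro a ⟨⟨m, hm, ha⟩, ⟨n, hn, hb⟩⟩
  refine ⟨m.ofDvd (Nat.gcd m n) (Nat.gcd_dvd_left _ _), fun l hl =>
    ⟨hm (hl.trans (Nat.gcd_dvd_left _ _)), hn (hl.trans (Nat.gcd_dvd_right _ _))⟩, ?_⟩
  rw [← addOrderOf_dvd_iff_nsmul_eq_zero] at ha hb ⊢
  exact Nat.dvd_gcd ha hb

theorem mem_Tor_sdiff {S : Set (KPrime F M)} {l : KPrime F M} {a : AddCircle (1 : ℚ)} :
    a ∈ Tor (S \ {l}) ↔ a ∈ Tor S ∧ a ∈ Tor ({l}ᶜ : Set (KPrime F M)) := by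
  rw [Set.sdiff_eq, Tor_inter, AddSubgroup.mem_inf]

/-- A prime dividing `𝐫`, as a positive integer dividing `𝐫`. -/
def KPrime.divisor (l : KPrime F M) : Divisor F M :=
  ⟨l, l.2.1.prime.squarefree, fun _ hp h => (Nat.prime_dvd_prime_iff_eq hp l.2.1).1 h ▸ l.2⟩

theorem mem_Tor_of_nsmul {S : Set (KPrime F M)} {l : KPrime F M} (hl : l ∈ S)
    {a : AddCircle (1 : ℚ)} (ha : (l : ℕ) • a = 0) : a ∈ Tor S :=
  ⟨l.divisor, fun q hq => by
    rwa [show q = l from Subtype.ext ((Nat.prime_dvd_prime_iff_eq q.2.1 l.2.1).1 hq)], ha⟩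

theorem mem_Tor_compl_of_nsmul {S : Set (KPrime F M)} {l : KPrime F M} {a : AddCircle (1 : ℚ)}
    (haS : a ∈ Tor S) {n : ℕ} (hn : ¬ (l : ℕ) ∣ n) (ha : n • a = 0) :
    a ∈ Tor ({l}ᶜ : Set (KPrime F M)) := by
  obtain ⟨m, -, hm⟩ := haS
  refine ⟨m.ofDvd (Nat.gcd m n) (Nat.gcd_dvd_left _ _), fun q hq hql => hn ?_, ?_⟩
  · rw [← Set.mem_singleton_iff.1 hql]
    exact hq.trans (Nat.gcd_dvd_right _ _)
  · rw [← addOrderOf_dvd_iff_nsmul_eq_zero] at ha hm ⊢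
    exact Nat.dvd_gcd hm ha

theorem exists_nsmul_of_mem_compl {l : KPrime F M} {a : AddCircle (1 : ℚ)}
    (ha : a ∈ Tor ({l}ᶜ : Set (KPrime F M))) : ∃ n : ℕ, n.Coprime l ∧ n ≠ 0 ∧ n • a = 0 := by
  obtain ⟨n, hn, ha⟩ := ha
  exact ⟨n, ((l.2.1.coprime_iff_not_dvd).2 fun h => hn h rfl).symm, n.ne_zero, ha⟩

theorem nsmul_mem_Tor_compl {S : Set (KPrime F M)} (l : KPrime F M) {a : AddCircle (1 : ℚ)}
    (ha : a ∈ Tor S) : (l : ℕ) • a ∈ Tor ({l}ᶜ : Set (KPrime F M)) := by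
  obtain ⟨n, hn, ha'⟩ := id ha
  have hla := (Tor S).nsmul_mem ha l
  by_cases h : (l : ℕ) ∣ n
  · obtain ⟨k, hk⟩ := h
    refine mem_Tor_compl_of_nsmul hla (n := k) (fun hd => ?_) (by
      rw [smul_smul, mul_comm, ← hk, ha'])
    obtain ⟨j, rfl⟩ := hd
    refine l.2.1.not_isUnit (n.2.1 l ⟨j, ?_⟩)
    rw [hk, mul_assoc]
  · exact mem_Tor_compl_of_nsmul hla h (by rw [smul_comm, ha', smul_zero])

theorem eq_zero_of_mem_compl {l : KPrime F M} {a : AddCircle (1 : ℚ)}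
    (ha : a ∈ Tor ({l}ᶜ : Set (KPrime F M))) (hl : (l : ℕ) • a = 0) : a = 0 := by
  obtain ⟨n, hn, -, hna⟩ := exists_nsmul_of_mem_compl ha
  rw [← addOrderOf_dvd_iff_nsmul_eq_zero] at hl hna
  exact AddMonoid.addOrderOf_eq_one_iff.1 (Nat.dvd_one.1 (hn ▸ Nat.dvd_gcd hna hl))

/-- Every element of `(1/𝐬)ℤ/ℤ` is the sum of an element of order prime to `ℓ` and an
`ℓ`-torsion element. -/
theorem exists_compl_part {S : Set (KPrime F M)} (l : KPrime F M) (a : Tor S) :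
    ∃ b : Tor S, (b : AddCircle (1 : ℚ)) ∈ Tor ({l}ᶜ : Set (KPrime F M)) ∧
      (l : ℕ) • (a - b) = 0 := by
  have hla := nsmul_mem_Tor_compl l a.2
  obtain ⟨n, hn, -, hna⟩ := exists_nsmul_of_mem_compl hla
  have hna' : n • (l : ℕ) • a = 0 := Subtype.ext hna
  have hb := Nat.gcd_eq_gcd_ab n l
  rw [hn, Nat.cast_one] at hb
  refine ⟨Nat.gcdB n l • (l : ℕ) • a, AddSubgroup.zsmul_mem _ hla _, ?_⟩
  have h1 : a - Nat.gcdB n l • (l : ℕ) • a = Nat.gcdA n l • n • a := by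
    rw [sub_eq_iff_eq_add, ← natCast_zsmul, ← natCast_zsmul, smul_smul, smul_smul, ← add_smul,
      mul_comm, mul_comm (Nat.gcdB _ _), ← hb, one_smul]
  rw [h1, smul_comm, smul_comm (l : ℕ), hna', smul_zero]

/-- An element of `(1/𝐬)ℤ/ℤ` of order prime to `ℓ` is divisible by `ℓ`. -/
theorem exists_nsmul_eq {S : Set (KPrime F M)} (l : KPrime F M) {a : Tor S}
    (ha : (a : AddCircle (1 : ℚ)) ∈ Tor ({l}ᶜ : Set (KPrime F M))) :
    ∃ b : Tor S, (b : AddCircle (1 : ℚ)) ∈ Tor ({l}ᶜ : Set (KPrime F M)) ∧ (l : ℕ) • b = a := by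
  obtain ⟨n, hn, -, hna⟩ := exists_nsmul_of_mem_compl ha
  have hna' : n • a = 0 := Subtype.ext hna
  have hb := Nat.gcd_eq_gcd_ab n l
  rw [hn, Nat.cast_one] at hb
  refine ⟨Nat.gcdB n l • a, AddSubgroup.zsmul_mem _ ha _, ?_⟩
  calc (l : ℕ) • Nat.gcdB n l • a = Nat.gcdA n l • n • a + (l : ℕ) • Nat.gcdB n l • a := by
        rw [hna', smul_zero, zero_add]
    _ = (1 : ℤ) • a := by
        rw [hb, ← natCast_zsmul, ← natCast_zsmul, smul_smul, smul_smul, ← add_smul,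
          mul_comm (Nat.gcdA _ _)]
    _ = a := one_smul _ _

/-- The element `1/ℓ` of `(1/𝐬)ℤ/ℤ`, for a prime `ℓ ∣ 𝐬`. -/
def invElt {S : Set (KPrime F M)} (l : KPrime F M) (hl : l ∈ S) : Tor S :=
  ⟨((1 / ((l : ℕ) : ℚ) : ℚ) : AddCircle (1 : ℚ)), mem_Tor_of_nsmul hl (by
    rw [← addOrderOf_dvd_iff_nsmul_eq_zero, AddCircle.addOrderOf_period_div l.2.1.pos])⟩

theorem addOrderOf_invElt {S : Set (KPrime F M)} (l : KPrime F M) (hl : l ∈ S) :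
    addOrderOf (invElt l hl) = l := by
  rw [← AddSubgroup.addOrderOf_coe]
  exact AddCircle.addOrderOf_period_div l.2.1.pos

theorem nsmul_invElt {S : Set (KPrime F M)} (l : KPrime F M) (hl : l ∈ S) :
    (l : ℕ) • invElt l hl = 0 := by
  rw [← addOrderOf_dvd_iff_nsmul_eq_zero, addOrderOf_invElt]

theorem invElt_ne_zero {S : Set (KPrime F M)} (l : KPrime F M) (hl : l ∈ S) :
    invElt l hl ≠ 0 := by
  rw [Ne, ← AddMonoid.addOrderOf_eq_one_iff, addOrderOf_invElt]
  exact l.2.1.ne_one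

theorem nsmul_eq_zero_iff_exists {S : Set (KPrime F M)} {l : KPrime F M} (hl : l ∈ S)
    {c : Tor S} : (l : ℕ) • c = 0 ↔ ∃ i < (l : ℕ), i • invElt l hl = c := by
  have h := AddCircle.nsmul_eq_zero_iff (p := (1 : ℚ)) (u := (c : AddCircle (1 : ℚ))) l.2.1.pos
  constructor
  · intro hc
    obtain ⟨m, hm, hmc⟩ := h.1 (congrArg Subtype.val hc)
    refine ⟨m, hm, Subtype.ext ?_⟩
    rw [← hmc, AddSubgroup.coe_nsmul, invElt, ← AddCircle.coe_nsmul]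
    congr 1
    rw [nsmul_eq_mul]
    ring
  · rintro ⟨i, -, rfl⟩
    rw [smul_comm, nsmul_invElt, smul_zero]

/-- In an abelian group, the elements killed by a squarefree number `n` are sums of elements
killed by primes dividing `n`. -/
theorem mem_of_nsmul_eq_zero {B : Type*} [AddCommGroup B] (H : AddSubgroup B) {n : ℕ}
    (hn : Squarefree n) (hH : ∀ p : ℕ, p.Prime → p ∣ n → ∀ c : B, p • c = 0 → c ∈ H)
    {a : B} (ha : n • a = 0) : a ∈ H := by
  induction n using induction_on_primes generalizing a with
  | zero => exact absurd rfl hn.ne_zero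
  | one => rw [one_smul] at ha; exact ha ▸ H.zero_mem
  | prime_mul p m hp ih =>
    have hcop : Nat.Coprime p m := Nat.coprime_of_squarefree_mul hn
    have hb := Nat.gcd_eq_gcd_ab p m
    rw [hcop, Nat.cast_one] at hb
    have h1 : m • a ∈ H := hH p hp (dvd_mul_right _ _) _ (by rw [smul_smul, ha])
    have h2 : p • a ∈ H := ih (hn.squarefree_of_dvd (dvd_mul_left _ _))
      (fun q hq hd => hH q hq (hd.trans (dvd_mul_left _ _))) (by rw [smul_smul, mul_comm, ha])
    have h3 : a = Nat.gcdA p m • p • a + Nat.gcdB p m • m • a := by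
      rw [← natCast_zsmul, ← natCast_zsmul, smul_smul, smul_smul, ← add_smul, mul_comm,
        mul_comm (Nat.gcdB _ _), ← hb, one_smul]
    rw [h3]
    exact H.add_mem (H.zsmul_mem h2 _) (H.zsmul_mem h1 _)

/-! ### The action of inertia and Frobenius on roots of unity -/

theorem natCast_notMem_of_coprime {R : Type*} [CommRing R] {P : Ideal R} [P.IsPrime] {p n : ℕ}
    [P.LiesOver (Ideal.span {(p : ℤ)})] (hn : n.Coprime p) : (n : R) ∉ P := by
  intro h
  have hp : (p : R) ∈ P := by
    have h1 : (p : ℤ) ∈ P.under ℤ := by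
      rw [← Ideal.LiesOver.over (P := P) (p := Ideal.span {(p : ℤ)})]
      exact Ideal.mem_span_singleton_self _
    simpa using h1
  have h2 := congrArg (Int.cast : ℤ → R) (Nat.gcd_eq_gcd_ab n p)
  rw [hn] at h2
  push_cast at h2
  refine (inferInstance : P.IsPrime).ne_top ((Ideal.eq_top_iff_one P).2 ?_)
  rw [h2]
  exact P.add_mem (P.mul_mem_right _ h) (P.mul_mem_right _ hp)

/-- An automorphism that acts as `x ↦ x ^ k` modulo `P` does so exactly on the roots of unity of
order prime to the residue characteristic `p`. -/
theorem apply_eq_pow_of_sub_mem {K : Type*} [Field K] {P : Ideal (𝓞 K)} [P.IsPrime] {p n k : ℕ}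
    [P.LiesOver (Ideal.span {(p : ℤ)})] (hn : n.Coprime p) (hn0 : n ≠ 0)
    (g : K ≃+* K) (hg : ∀ x y : 𝓞 K, (y : K) = g x → y - x ^ k ∈ P) {z : K} (hz : z ^ n = 1) :
    g z = z ^ k := by
  have hzi : IsIntegral ℤ z :=
    IsIntegral.of_pow (Nat.pos_of_ne_zero hn0) (by rw [hz]; exact isIntegral_one)
  have hgz : (g z) ^ n = 1 := by rw [← map_pow, hz, map_one]
  have hgi : IsIntegral ℤ (g z) :=
    IsIntegral.of_pow (Nat.pos_of_ne_zero hn0) (by rw [hgz]; exact isIntegral_one)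
  obtain ⟨x, rfl⟩ : ∃ x : 𝓞 K, (x : K) = z := ⟨⟨z, hzi⟩, rfl⟩
  obtain ⟨y, hy⟩ : ∃ y : 𝓞 K, (y : K) = g x := ⟨⟨_, hgi⟩, rfl⟩
  have hx1 : x ^ n = 1 := NumberField.RingOfIntegers.ext hz
  have hy1 : y ^ n = 1 := NumberField.RingOfIntegers.ext (by rw [← hy] at hgz; exact hgz)
  have h := eq_of_pow_eq_one_of_sub_mem (natCast_notMem_of_coprime (P := P) (p := p) hn)
    hy1 (y := x ^ k) (by rw [← pow_mul, mul_comm, pow_mul, hx1, one_pow]) (hg x y hy)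
  rw [← hy, h]
  rfl

/-- Inertia at `ℓ` acts trivially on `(1/(𝐫/ℓ))ℤ/ℤ`. -/
theorem IsInertiaGenerator.smul_eq_self {l : KPrime F M} {s : G F M} (hs : IsInertiaGenerator l s)
    {S : Set (KPrime F M)} {a : Tor S}
    (ha : (a : AddCircle (1 : ℚ)) ∈ Tor ({l}ᶜ : Set (KPrime F M))) :
    s • a = a := by
  obtain ⟨P, hP, hPl, hz⟩ := hs
  obtain ⟨n, hn, hn0, hna⟩ := exists_nsmul_of_mem_compl ha
  have hs : s ∈ P.inertia (G F M) := hz ▸ Subgroup.mem_zpowers s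
  rw [smul_eq s a hn0 (Subtype.ext hna) (m := 1), one_smul]
  intro z hz
  rw [zpow_one]
  have := apply_eq_pow_of_sub_mem (P := P) (p := l) (k := 1) hn hn0 s.toRingEquiv
    (fun x y hxy => ?_) hz
  · simpa using this
  · rw [pow_one, show y = s • x from NumberField.RingOfIntegers.ext hxy]
    exact hs x

/-- The Frobenius at `ℓ` acts on `(1/(𝐫/ℓ))ℤ/ℤ` as multiplication by `ℓ`; this is where residue
degree one is used. -/
theorem IsFrobenius.smul_eq {l : KPrime F M} {f : G F M} (hf : IsFrobenius l f)
    {S : Set (KPrime F M)} {a : Tor S}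
    (ha : (a : AddCircle (1 : ℚ)) ∈ Tor ({l}ᶜ : Set (KPrime F M))) :
    f • a = (l : ℕ) • a := by
  obtain ⟨P, hP, hPl, hfr⟩ := hf
  obtain ⟨n, hn, hn0, hna⟩ := exists_nsmul_of_mem_compl ha
  rw [UniversalKolyvagin.smul_eq f a hn0 (Subtype.ext hna) (m := (l : ℕ)), natCast_zsmul]
  have : (P.under (𝓞 F)).LiesOver (Ideal.span {((l : ℕ) : ℤ)}) := inferInstance
  have hcard : Nat.card (𝓞 F ⧸ P.under (𝓞 F)) = l := by
    have h1 := Ideal.pow_inertiaDeg l (P.under (𝓞 F))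
    rw [(l.2.2.2.2 (P.under (𝓞 F)) inferInstance this).2, pow_one] at h1
    rw [h1]; rfl
  intro z hz
  have := apply_eq_pow_of_sub_mem (P := P) (p := l) (k := l) hn hn0 f.toRingEquiv
    (fun x y hxy => ?_) hz
  · simpa using this
  · rw [show y = f • x from NumberField.RingOfIntegers.ext hxy]
    have := hfr x
    rwa [hcard] at this

theorem exists_primitiveRoot_prime (l : KPrime F M) :
    ∃ z : CycField F M, IsPrimitiveRoot z (l : ℕ) :=
  exists_primitiveRoot l.divisor

/-- The character by which `G` acts on the `ℓ`-torsion of `ℚ/ℤ`. -/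
def torsionChar (l : KPrime F M) : G F M →* (ZMod l)ˣ :=
  have : NeZero (l : ℕ) := ⟨l.2.1.ne_zero⟩
  (exists_primitiveRoot_prime l).choose_spec.autToPow F

theorem torsionChar_spec (l : KPrime F M) : ∃ z : CycField F M, IsPrimitiveRoot z l ∧
    ∀ g : G F M, g z = z ^ (torsionChar l g : ZMod l).val :=
  have : NeZero (l : ℕ) := ⟨l.2.1.ne_zero⟩
  ⟨_, (exists_primitiveRoot_prime l).choose_spec, fun g =>
    ((exists_primitiveRoot_prime l).choose_spec.autToPow_spec F g).symm⟩

theorem smul_eq_torsionChar {S : Set (KPrime F M)} {l : KPrime F M} (g : G F M) {c : Tor S}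
    (hc : (l : ℕ) • c = 0) : g • c = (torsionChar l g : ZMod l).val • c := by
  have : NeZero (l : ℕ) := ⟨l.2.1.ne_zero⟩
  obtain ⟨z, hz, hgz⟩ := torsionChar_spec l
  rw [smul_eq g c l.2.1.ne_zero hc (m := ((torsionChar l g : ZMod l).val : ℕ)), natCast_zsmul]
  intro w hw
  obtain ⟨i, -, rfl⟩ := hz.eq_pow_of_pow_eq_one hw
  rw [map_pow, hgz, zpow_natCast, ← pow_mul, ← pow_mul, mul_comm]

/-- The image of `σ_ℓ` generates `(ℤ/ℓ)ˣ`. -/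
theorem IsInertiaGenerator.mem_zpowers_torsionChar {l : KPrime F M} {s : G F M}
    (hs : IsInertiaGenerator l s) (v : (ZMod l)ˣ) : v ∈ Subgroup.zpowers (torsionChar l s) := by
  obtain ⟨P, hP, hPl, hzp⟩ := hs
  have hlp : Fact (l : ℕ).Prime := ⟨l.2.1⟩
  obtain ⟨z, hz, hgz⟩ := torsionChar_spec l
  have : (P.under (𝓞 F)).LiesOver (Ideal.span {((l : ℕ) : ℤ)}) := inferInstance
  have hram := (l.2.2.2.2 (P.under (𝓞 F)) inferInstance this).1
  obtain ⟨g, hg, hgv⟩ := exists_mem_inertia_eq_pow P hram hz (ZMod.val_coe_unit_coprime v)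
  rw [← hzp] at hg
  obtain ⟨j, rfl⟩ := hg
  refine ⟨j, ?_⟩
  change torsionChar l s ^ j = v
  rw [← map_zpow]
  exact Units.ext (ZMod.val_injective _
    (hz.pow_inj (ZMod.val_lt _) (ZMod.val_lt _) ((hgz _).symm.trans hgv)))

theorem IsInertiaGenerator.orderOf_torsionChar {l : KPrime F M} {s : G F M}
    (hs : IsInertiaGenerator l s) : orderOf (torsionChar l s) = l - 1 := by
  have hlp : Fact (l : ℕ).Prime := ⟨l.2.1⟩
  rw [← ZMod.card_units l, ← Nat.card_eq_fintype_card]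
  exact orderOf_eq_card_of_forall_mem_zpowers hs.mem_zpowers_torsionChar

/-! ### Rewriting in free abelian groups -/

/-- A linear form of the diamond lemma. Let `rhs j x` be a combination of elements smaller than `x`
for each rewriting rule `j` that applies to `x` (that is, `bad j x`), and suppose that the results
of two rules applied to `x` differ by rules applied below `x`. Then there is a linear operator
`E` on the free module (the normal form) that kills the relations `x - rhs j x` and differs from the
identity by them; so `ker E` is spanned by the relations. -/
theorem exists_normalForm {X J : Type*} {r : X → X → Prop} (wf : WellFounded r)
    (bad : J → X → Prop) (rhs : J → X → (X →₀ ℤ))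
    (hlt : ∀ j x, bad j x → ∀ y ∈ (rhs j x).support, r y x)
    (hconf : ∀ j k x, bad j x → bad k x → rhs j x - rhs k x ∈
      Submodule.span ℤ {z | ∃ i y, bad i y ∧ r y x ∧ z = Finsupp.single y 1 - rhs i y}) :
    ∃ E : (X →₀ ℤ) →ₗ[ℤ] (X →₀ ℤ),
      (∀ j x, bad j x → E (Finsupp.single x 1 - rhs j x) = 0) ∧
      ∀ z, z - E z ∈ Submodule.span ℤ {z | ∃ i y, bad i y ∧ z = Finsupp.single y 1 - rhs i y} := by
  classical
  set R := Submodule.span ℤ {z | ∃ i y, bad i y ∧ z = Finsupp.single y 1 - rhs i y} with hR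
  let step : ∀ x, (∀ y, r y x → (X →₀ ℤ)) → (X →₀ ℤ) := fun x rec =>
    if h : ∃ j, bad j x then
      ∑ y ∈ (rhs h.choose x).support.attach,
        rhs h.choose x y • rec y.1 (hlt _ x h.choose_spec y.1 y.2)
    else Finsupp.single x 1
  let e : X → (X →₀ ℤ) := wf.fix step
  let E : (X →₀ ℤ) →ₗ[ℤ] (X →₀ ℤ) := Finsupp.linearCombination ℤ e
  have hE1 : ∀ x, E (Finsupp.single x 1) = e x := fun x => by
    simp [E]
  have hfix : ∀ x, e x = step x fun y _ => e y := fun x => wf.fix_eq step x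
  have hbad : ∀ x (h : ∃ j, bad j x), e x = E (rhs h.choose x) := fun x h => by
    rw [hfix]
    simp only [step, dif_pos h]
    rw [Finset.sum_attach _ (fun y => rhs h.choose x y • e y)]
    rfl
  have hgood : ∀ x, (¬ ∃ j, bad j x) → e x = Finsupp.single x 1 := fun x h => by
    rw [hfix]
    simp only [step, dif_neg h]
  have hkill : ∀ x j, bad j x → E (Finsupp.single x 1 - rhs j x) = 0 := by
    intro x
    induction x using wf.induction with
    | _ x ih =>
      intro j hj
      have h : ∃ j, bad j x := ⟨j, hj⟩
      have h2 : E (rhs h.choose x - rhs j x) = 0 := by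
        have h3 := hconf _ j x h.choose_spec hj
        rw [← LinearMap.mem_ker]
        refine Submodule.span_le.2 ?_ h3
        rintro _ ⟨i, y, hi, hy, rfl⟩
        exact ih y hy i hi
      rw [map_sub, hE1, hbad x h, ← map_sub, h2]
  refine ⟨E, fun j x => hkill x j, ?_⟩
  have hsub : ∀ x, Finsupp.single x 1 - e x ∈ R := by
    intro x
    induction x using wf.induction with
    | _ x ih =>
      by_cases h : ∃ j, bad j x
      · have h1 : ∀ z : X →₀ ℤ, (∀ y ∈ z.support, r y x) → z - E z ∈ R := by
          intro z hz
          have h2 : z - E z = ∑ y ∈ z.support, z y • (Finsupp.single y 1 - e y) := by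
            have h3 : z = ∑ y ∈ z.support, z y • Finsupp.single y (1 : ℤ) := by
              conv_lhs => rw [← Finsupp.sum_single z]
              simp [Finsupp.sum]
            simp only [smul_sub, Finset.sum_sub_distrib]
            rw [← h3]
            rfl
          rw [h2]
          exact R.sum_mem fun y hy => R.smul_mem _ (ih y (hz y hy))
        have h2 := h1 _ (hlt _ x h.choose_spec)
        have h3 : Finsupp.single x 1 - rhs h.choose x ∈ R :=
          Submodule.subset_span ⟨_, x, h.choose_spec, rfl⟩
        rw [hbad x h]
        simpa using R.add_mem h3 h2
      · rw [hgood x h, sub_self]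
        exact R.zero_mem
  intro z
  induction z using Finsupp.induction_linear with
  | zero => simp
  | add a b ha hb => rw [map_add, add_sub_add_comm]; exact R.add_mem ha hb
  | single x n =>
    have := R.smul_mem n (hsub x)
    rw [← hE1, smul_sub, ← map_smul] at this
    simpa using this

/-! ### The universal distribution `U_𝐬` is torsion-free -/

variable {S : Set (KPrime F M)}

theorem finite_torsion_Tor (S : Set (KPrime F M)) (l : KPrime F M) :
    {c : Tor S | (l : ℕ) • c = 0}.Finite := by
  refine ((AddCircle.finite_torsion (1 : ℚ) l.2.1.pos).preimage
    (f := ((↑) : Tor S → AddCircle (1 : ℚ))) Subtype.val_injective.injOn).subset fun c hc => ?_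
  exact congrArg Subtype.val (show (l : ℕ) • c = 0 from hc)

/-- The `ℓ`-torsion of `(1/𝐬)ℤ/ℤ`. -/
def tors (S : Set (KPrime F M)) (l : KPrime F M) : Finset (Tor S) :=
  (finite_torsion_Tor S l).toFinset

theorem mem_tors {l : KPrime F M} {c : Tor S} : c ∈ tors S l ↔ (l : ℕ) • c = 0 := by
  simp [tors]

theorem mem_Tor_compl_of_mem_tors {l q : KPrime F M} (hlq : l ≠ q) {c : Tor S}
    (hc : c ∈ tors S l) : (c : AddCircle (1 : ℚ)) ∈ Tor ({q}ᶜ : Set (KPrime F M)) :=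
  mem_Tor_of_nsmul (l := l) hlq (congrArg Subtype.val (mem_tors.1 hc))

theorem eq_zero_of_mem_tors {l : KPrime F M} {c : Tor S}
    (hc : (c : AddCircle (1 : ℚ)) ∈ Tor ({l}ᶜ : Set (KPrime F M))) (hc' : c ∈ tors S l) : c = 0 :=
  Subtype.ext (eq_zero_of_mem_compl hc (congrArg Subtype.val (mem_tors.1 hc')))

theorem invElt_mem_tors (l : KPrime F M) (hl : l ∈ S) : invElt l hl ∈ tors S l :=
  mem_tors.2 (nsmul_invElt l hl)

theorem sub_mem_tors {l : KPrime F M} {c d : Tor S} (hc : c ∈ tors S l) (hd : d ∈ tors S l) :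
    c - d ∈ tors S l := by
  rw [mem_tors, smul_sub, mem_tors.1 hc, mem_tors.1 hd, sub_self]

/-- The distribution relation `[ℓ b] - ∑_{ℓ c = 0} [b + c]`. -/
def eulerRel (l : KPrime F M) (b : Tor S) : A S :=
  sym ((l : ℕ) • b) - ∑ c ∈ tors S l, sym (b + c)

/-- In the defining relations of `U_𝐬`, the element `a` can be written as `ℓ b` with `b` of order
prime to `ℓ`. -/
theorem isRelation_iff {z : A S} : IsRelation S z ↔
    ∃ l ∈ S, ∃ b : Tor S, (b : AddCircle (1 : ℚ)) ∈ Tor ({l}ᶜ : Set (KPrime F M)) ∧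
      z = eulerRel l b := by
  classical
  have key : ∀ (l : KPrime F M) (b : Tor S) (B : Finset (Tor S)),
      (∀ x, x ∈ B ↔ (l : ℕ) • x = (l : ℕ) • b) → ∑ x ∈ B, sym x = ∑ c ∈ tors S l, sym (b + c) := by
    intro l b B hB
    refine Finset.sum_bij' (fun x _ => x - b) (fun c _ => b + c) ?_ ?_ ?_ ?_ ?_
    · intro x hx
      rw [mem_tors, smul_sub, (hB x).1 hx, sub_self]
    · intro c hc
      rw [hB, smul_add, mem_tors.1 hc, add_zero]
    all_goals simp
  constructor
  · rintro ⟨l, hl, a, ha, B, hB, rfl⟩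
    obtain ⟨b, hb, rfl⟩ := exists_nsmul_eq l (mem_Tor_sdiff.1 ha).2
    exact ⟨l, hl, b, hb, by rw [eulerRel, key l b B hB]⟩
  · rintro ⟨l, hl, b, hb, rfl⟩
    have hB : ∀ x, x ∈ (tors S l).image (fun c => b + c) ↔ (l : ℕ) • x = (l : ℕ) • b := by
      intro x
      rw [Finset.mem_image]
      constructor
      · rintro ⟨c, hc, rfl⟩
        rw [smul_add, mem_tors.1 hc, add_zero]
      · intro hx
        exact ⟨x - b, by rw [mem_tors, smul_sub, hx, sub_self], by simp⟩
    refine ⟨l, hl, (l : ℕ) • b, mem_Tor_sdiff.2 ⟨((l : ℕ) • b).2, ?_⟩, _, hB, ?_⟩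
    · exact AddSubgroup.nsmul_mem _ hb _
    · rw [eulerRel, key l b _ hB]

/-- The symbol `[x]` is taken as the leading term of a distribution relation at `ℓ`: the
`ℓ`-primary part of `x` is exactly `1/ℓ`. -/
def IsLeading (l : S) (x : Tor S) : Prop :=
  ((x - invElt l.1 l.2 : Tor S) : AddCircle (1 : ℚ)) ∈ Tor ({l.1}ᶜ : Set (KPrime F M))

theorem isLeading_add_invElt {l : S} {b : Tor S} : IsLeading l (b + invElt l.1 l.2) ↔
    (b : AddCircle (1 : ℚ)) ∈ Tor ({l.1}ᶜ : Set (KPrime F M)) := by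
  rw [IsLeading, add_sub_cancel_right]

open Classical in
/-- The element by which `[x]` is replaced, for `x = b + 1/ℓ` with `b` of order prime to `ℓ`, when
the distribution relation `[ℓ b] = ∑_{ℓ c = 0} [b + c]` is solved for the term `c = 1/ℓ`. -/
def rewriteElt (l : S) (x : Tor S) : A S :=
  sym ((l.1 : ℕ) • (x - invElt l.1 l.2)) -
    ∑ c ∈ (tors S l.1).erase (invElt l.1 l.2), sym (x - invElt l.1 l.2 + c)

theorem sym_sub_rewriteElt (l : S) (x : Tor S) :
    sym x - rewriteElt l x = -eulerRel l.1 (x - invElt l.1 l.2) := by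
  classical
  rw [rewriteElt, eulerRel, ← Finset.add_sum_erase (tors S l.1) _
    (invElt_mem_tors l.1 l.2), sub_add_cancel]
  abel

/-- The order of `x` together with the number of primes at which `[x]` can be rewritten, compared
lexicographically. Rewriting decreases it: the terms `ℓ b` and `b` have smaller order than
`b + 1/ℓ`, and the terms `b + c` with `c ≠ 0, 1/ℓ` have the same order but are no longer leading
at `ℓ`. -/
def complexity (x : Tor S) : ℕ ×ₗ ℕ :=
  toLex (addOrderOf x, {l : S | IsLeading l x}.ncard)

theorem finite_isLeading (x : Tor S) : {l : S | IsLeading l x}.Finite := by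
  obtain ⟨n, hn0, hn⟩ := exists_nsmul x
  have hinj : Function.Injective (fun l : S => ((l : KPrime F M) : ℕ)) :=
    Subtype.val_injective.comp Subtype.val_injective
  refine ((Set.finite_Iic n).preimage hinj.injOn).subset fun l hl => ?_
  refine Nat.le_of_dvd (Nat.pos_of_ne_zero hn0) ?_
  by_contra hd
  have h1 := mem_Tor_compl_of_nsmul x.2 hd (congrArg Subtype.val hn)
  have h2 := AddSubgroup.sub_mem _ h1 hl
  rw [AddSubgroup.coe_sub, sub_sub_cancel] at h2
  exact invElt_ne_zero l.1 l.2 (eq_zero_of_mem_tors h2 (invElt_mem_tors l.1 l.2))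

theorem addOrderOf_pos_Tor (x : Tor S) : 0 < addOrderOf x := by
  obtain ⟨n, hn0, hn⟩ := exists_nsmul x
  exact addOrderOf_pos_iff.2 (isOfFinAddOrder_iff_nsmul_eq_zero.2 ⟨n, Nat.pos_of_ne_zero hn0, hn⟩)

theorem addOrderOf_add_torsion {l : KPrime F M} {b c : Tor S}
    (hb : (b : AddCircle (1 : ℚ)) ∈ Tor ({l}ᶜ : Set (KPrime F M))) (hc : c ∈ tors S l)
    (hc0 : c ≠ 0) : addOrderOf (b + c) = addOrderOf b * l := by
  have : Fact (l : ℕ).Prime := ⟨l.2.1⟩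
  have h1 : addOrderOf c = l := addOrderOf_eq_prime (mem_tors.1 hc) hc0
  obtain ⟨n, hn, -, hnb⟩ := exists_nsmul_of_mem_compl hb
  have h2 : (addOrderOf b).Coprime l := Nat.Coprime.coprime_dvd_left
    (addOrderOf_dvd_of_nsmul_eq_zero (Subtype.ext hnb)) hn
  rw [(AddCommute.all b c).addOrderOf_add_eq_mul_addOrderOf_of_coprime (h1 ▸ h2), h1]

theorem complexity_lt_of_addOrderOf_lt {x y : Tor S} (h : addOrderOf y < addOrderOf x) :
    complexity y < complexity x :=
  Prod.Lex.toLex_lt_toLex.2 (Or.inl h)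

theorem complexity_nsmul_lt {l : KPrime F M} {b c : Tor S} (k : ℕ)
    (hb : (b : AddCircle (1 : ℚ)) ∈ Tor ({l}ᶜ : Set (KPrime F M))) (hc : c ∈ tors S l)
    (hc0 : c ≠ 0) : complexity (k • b) < complexity (b + c) := by
  refine complexity_lt_of_addOrderOf_lt ?_
  rw [addOrderOf_add_torsion hb hc hc0]
  have h1 : addOrderOf (k • b) ≤ addOrderOf b := Nat.le_of_dvd (addOrderOf_pos_Tor b)
    (addOrderOf_dvd_of_nsmul_eq_zero (by rw [smul_comm, addOrderOf_nsmul_eq_zero, smul_zero]))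
  exact h1.trans_lt (lt_mul_of_one_lt_right (addOrderOf_pos_Tor b) l.2.1.one_lt)

theorem complexity_add_lt {l : S} {b c : Tor S}
    (hb : (b : AddCircle (1 : ℚ)) ∈ Tor ({l.1}ᶜ : Set (KPrime F M))) (hc : c ∈ tors S l.1)
    (hce : c ≠ invElt l.1 l.2) : complexity (b + c) < complexity (b + invElt l.1 l.2) := by
  have he := invElt_mem_tors l.1 l.2
  by_cases hc0 : c = 0
  · have h1 := complexity_nsmul_lt 1 hb he (invElt_ne_zero l.1 l.2)
    rw [hc0, add_zero]
    rwa [one_smul] at h1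
  refine Prod.Lex.toLex_lt_toLex.2 (Or.inr ⟨?_, ?_⟩)
  · rw [addOrderOf_add_torsion hb hc hc0, addOrderOf_add_torsion hb he (invElt_ne_zero l.1 l.2)]
  refine Set.ncard_lt_ncard ⟨fun q hq => ?_, fun hsub => ?_⟩ (finite_isLeading _)
  · have hq : IsLeading q (b + c) := hq
    change IsLeading q (b + invElt l.1 l.2)
    by_cases hql : q = l
    · rw [hql]
      exact isLeading_add_invElt.2 hb
    · have h1 := mem_Tor_compl_of_mem_tors (fun h => hql (Subtype.ext h.symm) : l.1 ≠ q.1)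
        (sub_mem_tors he hc)
      have h2 := AddSubgroup.add_mem _ hq h1
      rw [← AddSubgroup.coe_add] at h2
      rw [IsLeading]
      convert! h2 using 2
      abel
  · have h1 : IsLeading l (b + c) := hsub (isLeading_add_invElt.2 hb : IsLeading l _)
    have h2 := AddSubgroup.sub_mem _ h1 hb
    have h3 : (b + c - invElt l.1 l.2 : Tor S) - b = c - invElt l.1 l.2 := by abel
    rw [← AddSubgroup.coe_sub, h3] at h2
    exact hce (sub_eq_zero.1 (eq_zero_of_mem_tors h2 (sub_mem_tors hc he)))

theorem rewriteElt_support {l : S} {x : Tor S} (hx : IsLeading l x) {y : Tor S}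
    (hy : y ∈ (rewriteElt l x).support) : complexity y < complexity x := by
  classical
  obtain ⟨b, rfl⟩ : ∃ b, x = b + invElt l.1 l.2 := ⟨x - invElt l.1 l.2, by simp⟩
  rw [isLeading_add_invElt] at hx
  rw [rewriteElt, add_sub_cancel_right] at hy
  rcases Finset.mem_union.1 (Finsupp.support_sub hy) with h | h
  · rw [Finset.mem_singleton.1 (Finsupp.support_single_subset h)]
    exact complexity_nsmul_lt _ hx (invElt_mem_tors l.1 l.2) (invElt_ne_zero l.1 l.2)
  · obtain ⟨c, hc, hy⟩ := Finset.mem_biUnion.1 (Finsupp.support_finsetSum h)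
    rw [Finset.mem_singleton.1 (Finsupp.support_single_subset hy)]
    rw [Finset.mem_erase] at hc
    exact complexity_add_lt hx hc.2 hc.1

/-- The span of the relations whose leading symbol is simpler than `[x]`. -/
def relationsBelow (x : Tor S) : Submodule ℤ (A S) :=
  Submodule.span ℤ {z | ∃ (l : S) (y : Tor S), IsLeading l y ∧ complexity y < complexity x ∧
    z = sym y - rewriteElt l y}

theorem eulerRel_mem_relationsBelow {x b : Tor S} {q : S}
    (hb : (b : AddCircle (1 : ℚ)) ∈ Tor ({q.1}ᶜ : Set (KPrime F M)))
    (hlt : complexity (b + invElt q.1 q.2) < complexity x) :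
    eulerRel q.1 b ∈ relationsBelow x := by
  rw [← neg_mem_iff]
  refine Submodule.subset_span ⟨q, b + invElt q.1 q.2, isLeading_add_invElt.2 hb, hlt, ?_⟩
  rw [sym_sub_rewriteElt, add_sub_cancel_right]

open Classical in
/-- The result of rewriting `[b + 1/ℓ + 1/q]` both at `ℓ` and at `q`, for `b` of order prime to
`ℓ` and `q`; it is symmetric in `ℓ` and `q`. -/
def doubleRewrite (l q : S) (b : Tor S) : A S :=
  sym ((q.1 : ℕ) • (l.1 : ℕ) • b)
    - ∑ c ∈ (tors S q.1).erase (invElt q.1 q.2), sym ((l.1 : ℕ) • (b + c))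
    - ∑ c ∈ (tors S l.1).erase (invElt l.1 l.2), sym ((q.1 : ℕ) • (b + c))
    + ∑ c ∈ (tors S l.1).erase (invElt l.1 l.2), ∑ d ∈ (tors S q.1).erase (invElt q.1 q.2),
        sym (b + c + d)

theorem doubleRewrite_comm (l q : S) (b : Tor S) : doubleRewrite l q b = doubleRewrite q l b := by
  rw [doubleRewrite, doubleRewrite, Finset.sum_comm, smul_comm]
  simp only [add_right_comm]
  abel

/-- Multiplication by a prime `ℓ ≠ q` permutes the `q`-torsion. -/
theorem sum_tors_nsmul {l q : KPrime F M} (hlq : l ≠ q) (g : Tor S → A S) :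
    ∑ c ∈ tors S q, g ((l : ℕ) • c) = ∑ c ∈ tors S q, g c := by
  have hmaps : ∀ c ∈ tors S q, (l : ℕ) • c ∈ tors S q := fun c hc => by
    rw [mem_tors] at hc ⊢
    rw [smul_comm, hc, smul_zero]
  have hinj : Set.InjOn (fun c : Tor S => (l : ℕ) • c) (tors S q) := by
    intro c hc d hd hcd
    have h1 : (l : ℕ) • (c - d) = 0 := by rw [smul_sub, sub_eq_zero]; exact hcd
    exact sub_eq_zero.1 (eq_zero_of_mem_tors
      (mem_Tor_compl_of_mem_tors (Ne.symm hlq) (sub_mem_tors hc hd)) (mem_tors.2 h1))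
  refine Finset.sum_bij (fun c _ => (l : ℕ) • c) hmaps (fun c hc d hd h => hinj hc hd h) ?_
    (fun _ _ => rfl)
  exact fun d hd => by
    obtain ⟨c, hc, h⟩ := Finset.surjOn_of_injOn_of_card_le _ hmaps hinj le_rfl hd
    exact ⟨c, hc, h⟩

theorem rewriteElt_sub_doubleRewrite_mem {l q : S} (hlq : l ≠ q) {b : Tor S}
    (hbl : (b : AddCircle (1 : ℚ)) ∈ Tor ({l.1}ᶜ : Set (KPrime F M)))
    (hbq : (b : AddCircle (1 : ℚ)) ∈ Tor ({q.1}ᶜ : Set (KPrime F M))) :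
    rewriteElt l (b + invElt l.1 l.2 + invElt q.1 q.2) - doubleRewrite l q b ∈
      relationsBelow (b + invElt l.1 l.2 + invElt q.1 q.2) := by
  classical
  set el := invElt l.1 l.2
  set eq := invElt q.1 q.2
  have hel : el ∈ tors S l.1 := invElt_mem_tors l.1 l.2
  have heq : eq ∈ tors S q.1 := invElt_mem_tors q.1 q.2
  have hlqv : (l.1 : KPrime F M) ≠ q.1 := fun h => hlq (Subtype.ext h)
  have heql : (eq : AddCircle (1 : ℚ)) ∈ Tor ({l.1}ᶜ : Set (KPrime F M)) :=
    mem_Tor_compl_of_mem_tors (Ne.symm hlqv) heq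
  have htq : ∀ c ∈ tors S l.1, (c : AddCircle (1 : ℚ)) ∈ Tor ({q.1}ᶜ : Set (KPrime F M)) :=
    fun c hc => mem_Tor_compl_of_mem_tors hlqv hc
  have hbeq : ((b + eq : Tor S) : AddCircle (1 : ℚ)) ∈ Tor ({l.1}ᶜ : Set (KPrime F M)) :=
    AddSubgroup.add_mem _ hbl heql
  -- The relations at `q` used to rewrite the terms `[b + e_q + c]`.
  have h1 : ∑ c ∈ (tors S l.1).erase el, eulerRel q.1 (b + c) ∈ relationsBelow (b + el + eq) := by
    refine Submodule.sum_mem _ fun c hc => ?_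
    rw [Finset.mem_erase] at hc
    refine eulerRel_mem_relationsBelow (AddSubgroup.add_mem _ hbq (htq c hc.2)) ?_
    have := complexity_add_lt hbeq hc.2 hc.1
    rwa [add_right_comm b eq, add_right_comm b eq] at this
  -- The relation at `q` used to rewrite the term `[ℓ (b + e_q)]`.
  have h2 : eulerRel q.1 ((l.1 : ℕ) • b) ∈ relationsBelow (b + el + eq) := by
    refine eulerRel_mem_relationsBelow (AddSubgroup.nsmul_mem _ hbq _) ?_
    refine complexity_lt_of_addOrderOf_lt ?_
    have hq0 := invElt_ne_zero q.1 q.2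
    have hl0 := invElt_ne_zero l.1 l.2
    rw [addOrderOf_add_torsion (b := b + el) (AddSubgroup.add_mem _ hbq (htq _ hel)) heq hq0,
      addOrderOf_add_torsion (b := (l.1 : ℕ) • b) (AddSubgroup.nsmul_mem _ hbq _) heq hq0,
      addOrderOf_add_torsion hbl hel hl0]
    refine Nat.mul_lt_mul_of_pos_right ?_ q.1.2.1.pos
    have h1 : addOrderOf ((l.1 : ℕ) • b) ≤ addOrderOf b := Nat.le_of_dvd (addOrderOf_pos_Tor b)
      (addOrderOf_dvd_of_nsmul_eq_zero (by rw [smul_comm, addOrderOf_nsmul_eq_zero, smul_zero]))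
    exact h1.trans_lt (lt_mul_of_one_lt_right (addOrderOf_pos_Tor b) l.1.2.1.one_lt)
  have h3 : rewriteElt l (b + el + eq) - doubleRewrite l q b =
      ∑ c ∈ (tors S l.1).erase el, eulerRel q.1 (b + c) - eulerRel q.1 ((l.1 : ℕ) • b) := by
    have e1 : b + el + eq - el = b + eq := by abel
    have e2 := sum_tors_nsmul hlqv (fun c : Tor S => sym ((l.1 : ℕ) • b + c))
    simp only [← smul_add] at e2
    have e3 : ∀ c, ∑ d ∈ tors S q.1, sym (b + c + d) =
        sym (b + eq + c) + ∑ d ∈ (tors S q.1).erase eq, sym (b + c + d) := fun c => by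
      rw [← Finset.add_sum_erase _ _ heq, add_right_comm]
    rw [rewriteElt, doubleRewrite]
    simp only [eulerRel, Finset.sum_sub_distrib, e3, Finset.sum_add_distrib]
    change sym ((l.1 : ℕ) • (b + el + eq - el)) - ∑ c ∈ (tors S l.1).erase el,
      sym (b + el + eq - el + c) - _ = _
    rw [e1, ← e2, ← Finset.add_sum_erase (tors S q.1) _ heq]
    abel
  rw [h3]
  exact Submodule.sub_mem _ h1 h2

/-- Local confluence: the two ways of rewriting `[x]` agree up to relations at simpler symbols. -/
theorem rewriteElt_sub_rewriteElt_mem {l q : S} {x : Tor S} (hl : IsLeading l x)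
    (hq : IsLeading q x) : rewriteElt l x - rewriteElt q x ∈ relationsBelow x := by
  by_cases hlq : l = q
  · rw [hlq, sub_self]; exact Submodule.zero_mem _
  obtain ⟨b, rfl⟩ : ∃ b, x = b + invElt l.1 l.2 + invElt q.1 q.2 :=
    ⟨x - invElt q.1 q.2 - invElt l.1 l.2, by simp⟩
  have htors : ∀ {l q : S}, l ≠ q →
      ((invElt l.1 l.2 : Tor S) : AddCircle (1 : ℚ)) ∈ Tor ({q.1}ᶜ : Set (KPrime F M)) :=
    fun {l q} hlq => mem_Tor_compl_of_mem_tors (fun h => hlq (Subtype.ext h))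
      (invElt_mem_tors l.1 l.2)
  have hbq : (b : AddCircle (1 : ℚ)) ∈ Tor ({q.1}ᶜ : Set (KPrime F M)) := by
    rw [isLeading_add_invElt] at hq
    simpa using AddSubgroup.sub_mem _ hq (htors hlq)
  have hbl : (b : AddCircle (1 : ℚ)) ∈ Tor ({l.1}ᶜ : Set (KPrime F M)) := by
    rw [add_right_comm, isLeading_add_invElt] at hl
    simpa using AddSubgroup.sub_mem _ hl (htors (Ne.symm hlq))
  have h1 := rewriteElt_sub_doubleRewrite_mem hlq hbl hbq
  have h2 := rewriteElt_sub_doubleRewrite_mem (Ne.symm hlq) hbq hbl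
  rw [add_right_comm b, doubleRewrite_comm] at h2
  simpa using Submodule.sub_mem _ h1 h2

/-- The group `U_𝐬` is torsion-free: it is isomorphic to the image of the normal form operator,
inside a free abelian group. -/
theorem smul_eq_zero_U {n : ℤ} (hn : n ≠ 0) {x : U S} (hx : n • x = 0) : x = 0 := by
  obtain ⟨E, hE1, hE2⟩ := exists_normalForm (InvImage.wf complexity wellFounded_lt)
    IsLeading (rewriteElt (S := S)) (fun l x hx y hy => rewriteElt_support hx hy)
    (fun l q x hl hq => rewriteElt_sub_rewriteElt_mem hl hq)
  have hspan : Submodule.span ℤ {z | ∃ (l : S) (y : Tor S), IsLeading l y ∧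
      z = Finsupp.single y 1 - rewriteElt l y} = relations S := by
    refine le_antisymm (Submodule.span_le.2 ?_) (Submodule.span_le.2 ?_)
    · rintro _ ⟨l, y, hy, rfl⟩
      change sym y - rewriteElt l y ∈ relations S
      rw [sym_sub_rewriteElt, neg_mem_iff]
      exact Submodule.subset_span (isRelation_iff.2 ⟨l.1, l.2, _, hy, rfl⟩)
    · intro z hz
      obtain ⟨l, hl, b, hb, rfl⟩ := isRelation_iff.1 hz
      rw [SetLike.mem_coe, ← neg_mem_iff]
      refine Submodule.subset_span ⟨⟨l, hl⟩, b + invElt l hl,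
        (isLeading_add_invElt (l := ⟨l, hl⟩)).2 hb, ?_⟩
      exact (by rw [add_sub_cancel_right] : -eulerRel l b =
        -eulerRel l (b + invElt l hl - invElt l hl)).trans (sym_sub_rewriteElt ⟨l, hl⟩ _).symm
  have hker : ∀ z ∈ relations S, E z = 0 := by
    intro z hz
    rw [← hspan] at hz
    refine (Submodule.span_le (p := LinearMap.ker E)).2 ?_ hz
    rintro _ ⟨l, y, hy, rfl⟩
    exact hE1 l y hy
  obtain ⟨z, rfl⟩ := Submodule.Quotient.mk_surjective _ x
  rw [← Submodule.Quotient.mk_smul, Submodule.Quotient.mk_eq_zero] at hx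
  have h1 := hker _ hx
  rw [map_smul, smul_eq_zero, or_iff_right hn] at h1
  rw [Submodule.Quotient.mk_eq_zero, ← hspan]
  simpa [h1] using hE2 z

/-! ### The classes of the symbols in `U_𝐬` -/

/-- The class of `[a]` in `U_𝐬`. -/
def symU (a : Tor S) : U S := Submodule.Quotient.mk (sym a)

theorem repU_symU (g : G F M) (a : Tor S) : repU S g (symU a) = symU (g • a) :=
  congrArg Submodule.Quotient.mk (repA_sym g a)

theorem incl_symU {S' : Set (KPrime F M)} (h : S ⊆ S') (a : Tor S) :
    incl h (symU a) = symU (AddSubgroup.inclusion (Tor_mono h) a) := by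
  change Submodule.Quotient.mk _ = Submodule.Quotient.mk _
  simp [sym]

theorem linearMap_ext_symU {V : Type*} [AddCommGroup V] {f g : U S →ₗ[ℤ] V}
    (h : ∀ a, f (symU a) = g (symU a)) : f = g :=
  Submodule.linearMap_qext _ (Finsupp.lhom_ext' fun a => LinearMap.ext_ring (h a))

theorem induction_symU {p : U S → Prop} (x : U S) (hsym : ∀ a, p (symU a)) (hzero : p 0)
    (hadd : ∀ x y, p x → p y → p (x + y)) (hneg : ∀ x, p x → p (-x)) : p x := by
  obtain ⟨z, rfl⟩ := Submodule.Quotient.mk_surjective _ x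
  let H : AddSubgroup (U S) :=
    { carrier := {x | p x}, zero_mem' := hzero, add_mem' := hadd _ _, neg_mem' := hneg _ }
  change Submodule.Quotient.mk z ∈ H
  induction z using Finsupp.induction_linear with
  | zero => exact H.zero_mem
  | add a b ha hb => exact H.add_mem ha hb
  | single a n =>
    have h1 : Finsupp.single a n = n • sym a := by simp [sym]
    rw [h1, Submodule.Quotient.mk_smul]
    exact H.zsmul_mem (hsym a) n

theorem repU_incl {S' : Set (KPrime F M)} (h : S ⊆ S') (g : G F M) (x : U S) :
    repU S' g (incl h x) = incl h (repU S g x) := by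
  refine LinearMap.congr_fun (f := repU S' g ∘ₗ incl h) (g := incl h ∘ₗ repU S g)
    (linearMap_ext_symU fun a => ?_) x
  simp only [LinearMap.comp_apply, repU_symU, incl_symU]
  rfl

theorem incl_incl {S' S'' : Set (KPrime F M)} (h : S ⊆ S') (h' : S' ⊆ S'') (x : U S) :
    incl h' (incl h x) = incl (h.trans h') x := by
  refine LinearMap.congr_fun (f := incl h' ∘ₗ incl h) (g := incl (h.trans h'))
    (linearMap_ext_symU fun a => ?_) x
  simp only [LinearMap.comp_apply, incl_symU]
  rfl

theorem smul_smul_comm (g h : G F M) (a : Tor S) : g • h • a = h • g • a := by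
  obtain ⟨n, hn, ha⟩ := exists_nsmul a
  have hg := fun z hz => exponent_spec g hn (z := z) hz
  have hh := fun z hz => exponent_spec h hn (z := z) hz
  rw [smul_eq h a hn ha hh, smul_eq g a hn ha hg,
    smul_eq g _ hn (by rw [smul_comm, ha, smul_zero]) hg,
    smul_eq h _ hn (by rw [smul_comm, ha, smul_zero]) hh, smul_comm]

theorem repU_comm (g h : G F M) : Commute (repU S g) (repU S h) := by
  refine linearMap_ext_symU fun a => ?_
  simp only [Module.End.mul_apply, repU_symU, smul_smul_comm g h a]

theorem repU_congr {g h : G F M} (H : ∀ a : Tor S, g • a = h • a) : repU S g = repU S h :=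
  linearMap_ext_symU fun a => by rw [repU_symU, repU_symU, H]

/-! ### Operators in the group ring -/

theorem asAlgebraHom_mem_of_stable {V : Type*} [AddCommGroup V]
    (ρ : Representation ℤ (G F M) V) {N : Submodule ℤ V} (hN : ∀ g, ∀ x ∈ N, ρ g x ∈ N)
    (t : MonoidAlgebra ℤ (G F M)) {x : V} (hx : x ∈ N) : ρ.asAlgebraHom t x ∈ N := by
  induction t using MonoidAlgebra.induction_on with
  | of g => rw [Representation.asAlgebraHom_of]; exact hN g x hx
  | add a b ha hb => rw [map_add]; exact N.add_mem ha hb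
  | smul n a ha => rw [map_smul]; exact N.smul_mem n ha

theorem asAlgebraHom_intertwine {V W : Type*} [AddCommGroup V] [AddCommGroup W]
    {ρ : Representation ℤ (G F M) V} {ρ' : Representation ℤ (G F M) W} (φ : V →ₗ[ℤ] W)
    (h : ∀ g x, φ (ρ g x) = ρ' g (φ x)) (t : MonoidAlgebra ℤ (G F M)) (x : V) :
    φ (ρ.asAlgebraHom t x) = ρ'.asAlgebraHom t (φ x) := by
  induction t using MonoidAlgebra.induction_on with
  | of g => rw [Representation.asAlgebraHom_of, Representation.asAlgebraHom_of]; exact h g x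
  | add a b ha hb => simp only [map_add, LinearMap.add_apply, ha, hb]
  | smul n a ha => simp only [map_smul, LinearMap.smul_apply, ha]

theorem asAlgebraHom_comm (t t' : MonoidAlgebra ℤ (G F M)) :
    Commute ((repU S).asAlgebraHom t) ((repU S).asAlgebraHom t') := by
  refine LinearMap.ext fun x => ?_
  refine asAlgebraHom_intertwine ((repU S).asAlgebraHom t) (fun g x => ?_) t' x
  exact (asAlgebraHom_intertwine (repU S g)
    (fun h y => LinearMap.congr_fun (repU_comm g h).eq y) t x).symm

open Classical in
/-- The action of `N'_r` as a product over the bare list of prime factors of `r`, without the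
membership proofs that `deriv` carries along. -/
theorem asAlgebraHom_deriv (s : KPrime F M → G F M) (r : Divisor F M) :
    (repU S).asAlgebraHom (deriv s r) = ((r : ℕ).primeFactorsList.map fun p =>
      if hp : IsKPrime F M p then (repU S).asAlgebraHom (derivPrime p (s ⟨p, hp⟩))
      else 1).prod := by
  rw [deriv, map_list_prod, List.map_map]
  conv_rhs => rw [← List.attach_map_subtype_val (r : ℕ).primeFactorsList, List.map_map]
  congr 1
  refine List.map_congr_left fun p _ => ?_
  have hp : IsKPrime F M p.1 := r.2.2 p.1 (Nat.prime_of_mem_primeFactorsList p.2)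
    (Nat.dvd_of_mem_primeFactorsList p.2)
  simp only [Function.comp_apply, dif_pos hp]

theorem asAlgebraHom_deriv_quot (s : KPrime F M → G F M) (r : Divisor F M) (l : KPrime F M)
    (h : (l : ℕ) ∣ r) : (repU S).asAlgebraHom (deriv s r) =
      (repU S).asAlgebraHom (derivPrime l (s l)) *
        (repU S).asAlgebraHom (deriv s (r.quot l h)) := by
  classical
  rw [asAlgebraHom_deriv, asAlgebraHom_deriv]
  have hperm : (r : ℕ).primeFactorsList.Perm
      ((l : ℕ) :: ((r.quot l h : Divisor F M) : ℕ).primeFactorsList) := by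
    have h1 := Nat.perm_primeFactorsList_mul l.2.1.ne_zero (r.quot l h).ne_zero
    rw [Nat.primeFactorsList_prime l.2.1] at h1
    have h2 : (l : ℕ) * ((r.quot l h : Divisor F M) : ℕ) = r := Nat.mul_div_cancel' h
    rwa [h2] at h1
  rw [(hperm.map _).prod_eq', List.map_cons, List.prod_cons, dif_pos l.2]
  refine List.pairwise_map.2 (List.pairwise_iff_getElem.2 fun i j _ _ _ => ?_)
  split_ifs
  · exact asAlgebraHom_comm _ _
  all_goals simp

/-! ### The Euler system relation -/

theorem sum_symU_add_tors {l : KPrime F M} (hl : l ∈ S) {b : Tor S}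
    (hb : (b : AddCircle (1 : ℚ)) ∈ Tor ({l}ᶜ : Set (KPrime F M))) :
    ∑ c ∈ tors S l, symU (b + c) = symU ((l : ℕ) • b) := by
  have h1 : (Submodule.Quotient.mk (eulerRel l b) : U S) = 0 :=
    (Submodule.Quotient.mk_eq_zero _).2
      (Submodule.subset_span (isRelation_iff.2 ⟨l, hl, b, hb, rfl⟩))
  rw [eulerRel, Submodule.Quotient.mk_sub, sub_eq_zero] at h1
  exact ((map_sum (relations S).mkQ (fun c => sym (b + c)) (tors S l)).symm.trans h1.symm)

theorem nsmul_invElt_inj {l : KPrime F M} (hl : l ∈ S) {i j : ℕ} (hi : i < l) (hj : j < l)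
    (h : i • invElt l hl = j • invElt l hl) : i = j :=
  nsmul_injOn_Iio_addOrderOf (x := invElt l hl) (by rwa [Set.mem_Iio, addOrderOf_invElt])
    (by rwa [Set.mem_Iio, addOrderOf_invElt]) h

theorem card_tors {l : KPrime F M} (hl : l ∈ S) : (tors S l).card = l := by
  rw [← Finset.card_range (l : ℕ)]
  symm
  refine Finset.card_bij (fun i _ => i • invElt l hl) (fun i _ => ?_) (fun i hi j hj h => ?_)
    (fun c hc => ?_)
  · rw [mem_tors, smul_comm, nsmul_invElt, smul_zero]
  · exact nsmul_invElt_inj hl (Finset.mem_range.1 hi) (Finset.mem_range.1 hj) h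
  · obtain ⟨i, hi, rfl⟩ := (nsmul_eq_zero_iff_exists hl).1 (mem_tors.1 hc)
    exact ⟨i, Finset.mem_range.2 hi, rfl⟩

open Classical in
/-- The `ℓ - 1` conjugates of `1/ℓ` under `σ_ℓ` are the nonzero elements of the `ℓ`-torsion. -/
theorem sum_range_pow_smul_invElt {V : Type*} [AddCommMonoid V] {l : KPrime F M} {s : G F M}
    (hs : IsInertiaGenerator l s) (hl : l ∈ S) (φ : Tor S → V) :
    ∑ i ∈ Finset.range (l - 1), φ (s ^ i • invElt l hl) = ∑ c ∈ (tors S l).erase 0, φ c := by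
  have hlp : Fact (l : ℕ).Prime := ⟨l.2.1⟩
  have hsmul : ∀ i : ℕ, s ^ i • invElt l hl =
      ((torsionChar l s ^ i : (ZMod l)ˣ) : ZMod l).val • invElt l hl := fun i => by
    rw [smul_eq_torsionChar _ (nsmul_invElt l hl), map_pow]
  refine Finset.sum_bij (fun i _ => s ^ i • invElt l hl) (fun i _ => ?_) (fun i hi j hj h => ?_)
    (fun c hc => ?_) (fun _ _ => rfl)
  · rw [Finset.mem_erase, mem_tors, smul_comm, nsmul_invElt, smul_zero]
    exact ⟨(smul_ne_zero_iff_ne _).2 (invElt_ne_zero l hl), rfl⟩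
  · simp only [hsmul] at h
    have h1 := nsmul_invElt_inj hl (ZMod.val_lt _) (ZMod.val_lt _) h
    refine pow_injOn_Iio_orderOf (x := torsionChar l s) ?_ ?_ (Units.ext (ZMod.val_injective _ h1))
    · rw [Set.mem_Iio, hs.orderOf_torsionChar]
      exact Finset.mem_range.1 hi
    · rw [Set.mem_Iio, hs.orderOf_torsionChar]
      exact Finset.mem_range.1 hj
  · rw [Finset.mem_erase, mem_tors] at hc
    obtain ⟨j, hj, rfl⟩ := (nsmul_eq_zero_iff_exists hl).1 hc.2
    have hj0 : j ≠ 0 := by rintro rfl; simp at hc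
    have hcop : j.Coprime l := (Nat.coprime_of_lt_prime hj0 hj l.2.1).symm
    obtain ⟨i, hi, hiv⟩ := Finset.mem_image.1 (mem_zpowers_iff_mem_range_orderOf.1
      (hs.mem_zpowers_torsionChar (ZMod.unitOfCoprime j hcop)))
    refine ⟨i, ?_, ?_⟩
    · rwa [← hs.orderOf_torsionChar]
    · rw [hsmul, hiv, ZMod.coe_unitOfCoprime, ZMod.val_natCast, Nat.mod_eq_of_lt hj]

/-- The norm relation of the universal Euler system: the trace of `[b + 1/ℓ]` under the inertia
group at `ℓ` is `(Frob_ℓ - 1) [b]`, for `b` of order prime to `ℓ`. -/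
theorem sum_repU_pow_symU {l : KPrime F M} {s f : G F M} (hs : IsInertiaGenerator l s)
    (hf : IsFrobenius l f) (hl : l ∈ S) {b : Tor S}
    (hb : (b : AddCircle (1 : ℚ)) ∈ Tor ({l}ᶜ : Set (KPrime F M))) :
    ∑ i ∈ Finset.range (l - 1), repU S (s ^ i) (symU (b + invElt l hl)) =
      repU S f (symU b) - symU b := by
  classical
  have hsb : ∀ i : ℕ, s ^ i • b = b := fun i => by
    induction i with
    | zero => rw [pow_zero, one_smul]
    | succ n ih => rw [pow_succ, mul_smul, hs.smul_eq_self hb, ih]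
  simp only [repU_symU, smul_add, hsb]
  rw [sum_range_pow_smul_invElt hs hl (fun c => symU (b + c)), hf.smul_eq hb,
    ← sum_symU_add_tors hl hb, ← Finset.add_sum_erase (tors S l) _ (mem_tors.2 (smul_zero _)),
    add_zero, add_sub_cancel_left]

theorem pow_smul_eq_self {l : KPrime F M} {s : G F M} (hs : IsInertiaGenerator l s) (a : Tor S) :
    s ^ ((l : ℕ) - 1) • a = a := by
  obtain ⟨b, hb, hab⟩ := exists_compl_part l a
  have hsb : ∀ i : ℕ, s ^ i • b = b := fun i => by
    induction i with
    | zero => rw [pow_zero, one_smul]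
    | succ n ih => rw [pow_succ, mul_smul, hs.smul_eq_self hb, ih]
  have h1 : s ^ ((l : ℕ) - 1) • (a - b) = a - b := by
    have : Fact (1 < (l : ℕ)) := ⟨l.2.1.one_lt⟩
    rw [smul_eq_torsionChar _ hab, map_pow, ← hs.orderOf_torsionChar, pow_orderOf_eq_one,
      Units.val_one, ZMod.val_one, one_smul]
  rwa [smul_sub, hsb, sub_left_inj] at h1

/-- The telescoping identity `(σ_ℓ - 1) N'_ℓ = (ℓ - 1) - ∑_i σ_ℓ ^ i` in `End(U_𝐬)`. -/
theorem asAlgebraHom_derivPrime {l : KPrime F M} {s : G F M} (hs : IsInertiaGenerator l s)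
    (x : U S) :
    repU S s ((repU S).asAlgebraHom (derivPrime l s) x) - (repU S).asAlgebraHom (derivPrime l s) x =
      (((l : ℕ) : ℤ) - 1) • x - ∑ i ∈ Finset.range (l - 1), repU S (s ^ i) x := by
  have h1 : (repU S).asAlgebraHom (derivPrime l s) x =
      ∑ i ∈ Finset.range (l - 1), (i : ℤ) • repU S (s ^ i) x := by
    rw [derivPrime, map_sum, LinearMap.sum_apply]
    have : Finset.range ((l : ℕ) - 1) = insert 0 (Finset.Icc 1 ((l : ℕ) - 2)) := by
      ext i
      have := l.2.1.two_le
      simp only [Finset.mem_range, Finset.mem_insert, Finset.mem_Icc]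
      omega
    rw [this, Finset.sum_insert (by simp)]
    simp [-MonoidAlgebra.of_apply, Representation.asAlgebraHom_of]
  -- The partial sums of `∑ i σ ^ i` up to `n` have a boundary term `n σ ^ n`.
  have h2 : ∀ n : ℕ, repU S s (∑ i ∈ Finset.range n, (i : ℤ) • repU S (s ^ i) x) -
      ∑ i ∈ Finset.range n, (i : ℤ) • repU S (s ^ i) x =
      (n : ℤ) • repU S (s ^ n) x - ∑ i ∈ Finset.range n, repU S (s ^ (i + 1)) x := by
    intro n
    induction n with
    | zero => simp
    | succ n ih =>
      rw [Finset.sum_range_succ, Finset.sum_range_succ (fun i => repU S (s ^ (i + 1)) x), map_add,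
        add_sub_add_comm, ih, map_smul, pow_succ' s n, map_mul]
      simp only [Module.End.mul_apply]
      push_cast
      module
  have h3 : repU S (s ^ ((l : ℕ) - 1)) x = x := by
    rw [repU_congr (h := 1) (fun a => by rw [pow_smul_eq_self hs, one_smul]), map_one]
    rfl
  have h4 := Finset.sum_range_succ (fun i => repU S (s ^ i) x) ((l : ℕ) - 1)
  rw [Finset.sum_range_succ', h3, pow_zero, map_one, Module.End.one_apply, add_left_inj] at h4
  rw [h1, h2, h3, h4, Nat.cast_sub l.2.1.one_le]
  simp

/-! ### Invariance of the universal Kolyvagin classes -/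

theorem red_mem_H0 {x : U S} :
    red x ∈ H0 S ↔ ∀ g : G F M, ∃ w : U S, repU S g x - x = (M : ℤ) • w := by
  rw [Representation.mem_invariants]
  refine forall_congr' fun g => ?_
  change Submodule.Quotient.mk (repU S g x) = Submodule.Quotient.mk x ↔ _
  rw [Submodule.Quotient.eq]
  exact ⟨fun ⟨w, hw⟩ => ⟨w, hw.symm⟩, fun ⟨w, hw⟩ => ⟨w, hw.symm⟩⟩

theorem primes_quot_subset (r : Divisor F M) (l : KPrime F M) (h : (l : ℕ) ∣ r) :
    (r.quot l h).primes ⊆ r.primes :=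
  fun _ hq => hq.trans (Nat.div_dvd_of_dvd h)

theorem primes_quot_subset_compl (r : Divisor F M) (l : KPrime F M) (h : (l : ℕ) ∣ r) :
    (r.quot l h).primes ⊆ {l}ᶜ := by
  rintro q hq rfl
  refine q.2.1.not_isUnit (r.2.1 q ?_)
  have h1 : (q : ℕ) * ((r.quot q h : Divisor F M) : ℕ) = r := Nat.mul_div_cancel' h
  rw [← h1]
  exact mul_dvd_mul_left _ hq

/-- The elements `x_r` and `x_{r/ℓ}` are `[b + 1/ℓ]` and `[b]`, where `b` is the sum of the `1/p`
over the primes `p ≠ ℓ` dividing `r`. -/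
theorem exists_xElt_quot {r : Divisor F M} (hr : r.primes ⊆ S) {l : KPrime F M} (h : (l : ℕ) ∣ r)
    (hl : l ∈ S) :
    ∃ b : Tor S, (b : AddCircle (1 : ℚ)) ∈ Tor ({l}ᶜ : Set (KPrime F M)) ∧
      incl hr (xElt r) = symU (b + invElt l hl) ∧
      incl ((primes_quot_subset r l h).trans hr) (xElt (r.quot l h)) = symU b := by
  have hr' := (primes_quot_subset r l h).trans hr
  refine ⟨AddSubgroup.inclusion (Tor_mono hr') ⟨_, sum_inv_mem (r.quot l h)⟩,
    Tor_mono (primes_quot_subset_compl r l h) (sum_inv_mem (r.quot l h)), ?_, incl_symU _ _⟩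
  refine (incl_symU hr _).trans (congrArg symU (Subtype.ext ?_))
  change ∑ p ∈ (r : ℕ).primeFactors, ((1 / (p : ℚ) : ℚ) : AddCircle (1 : ℚ)) =
    ∑ p ∈ ((r.quot l h : Divisor F M) : ℕ).primeFactors, ((1 / (p : ℚ) : ℚ) : AddCircle (1 : ℚ)) +
      ((1 / ((l : ℕ) : ℚ) : ℚ) : AddCircle (1 : ℚ))
  have h1 : (l : ℕ) * ((r.quot l h : Divisor F M) : ℕ) = r := Nat.mul_div_cancel' h
  have h2 : (r : ℕ).primeFactors =
      insert (l : ℕ) ((r.quot l h : Divisor F M) : ℕ).primeFactors := by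
    rw [← h1, Nat.primeFactors_mul l.2.1.ne_zero (r.quot l h).ne_zero, l.2.1.primeFactors]
    rfl
  rw [h2, Finset.sum_insert, add_comm]
  intro hmem
  exact primes_quot_subset_compl r l h (Nat.dvd_of_mem_primeFactors hmem : l ∈ _) rfl

theorem incl_kolyvaginElt (s : KPrime F M → G F M) {r : Divisor F M} (hr : r.primes ⊆ S) :
    incl hr (kolyvaginElt s r) = (repU S).asAlgebraHom (deriv s r) (incl hr (xElt r)) :=
  asAlgebraHom_intertwine (incl hr) (fun g x => (repU_incl hr g x).symm) _ _

/-- The identity `(σ_ℓ - 1) N'_r x_r = (ℓ - 1) N'_{r/ℓ} x_r - (Frob_ℓ - 1) N'_{r/ℓ} x_{r/ℓ}`,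
obtained from the telescoping identity for `N'_ℓ` and the norm relation. -/
theorem repU_kolyvaginElt_sub {s f : KPrime F M → G F M} (hs : ∀ l, IsInertiaGenerator l (s l))
    (hf : ∀ l, IsFrobenius l (f l)) {r : Divisor F M} (hr : r.primes ⊆ S) {l : KPrime F M}
    (h : (l : ℕ) ∣ r) :
    repU S (s l) (incl hr (kolyvaginElt s r)) - incl hr (kolyvaginElt s r) =
      (((l : ℕ) : ℤ) - 1) • (repU S).asAlgebraHom (deriv s (r.quot l h)) (incl hr (xElt r)) -
        (repU S (f l) (incl ((primes_quot_subset r l h).trans hr) (kolyvaginElt s (r.quot l h))) -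
          incl ((primes_quot_subset r l h).trans hr) (kolyvaginElt s (r.quot l h))) := by
  have hr' := (primes_quot_subset r l h).trans hr
  obtain ⟨b, hb, hxr, hxq⟩ := exists_xElt_quot hr h (hr h)
  have hcomm : ∀ g x, (repU S).asAlgebraHom (deriv s (r.quot l h)) (repU S g x) =
      repU S g ((repU S).asAlgebraHom (deriv s (r.quot l h)) x) := fun g x =>
    (asAlgebraHom_intertwine (repU S g)
      (fun h y => LinearMap.congr_fun (repU_comm g h).eq y) _ x).symm
  rw [incl_kolyvaginElt, asAlgebraHom_deriv_quot s r l h, Module.End.mul_apply,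
    asAlgebraHom_derivPrime (hs l), incl_kolyvaginElt, hxq, ← hcomm, ← map_sub,
    ← sum_repU_pow_symU (hs l) (hf l) (hr h) hb, map_sum, hxr]
  simp only [hcomm]

theorem smul_eq_self_of_mem_closure {s : KPrime F M → G F M}
    (hs : ∀ l, IsInertiaGenerator l (s l)) {T : Set (KPrime F M)} {q : KPrime F M} (hq : q ∉ T)
    {g : G F M} (hg : g ∈ Subgroup.closure (s '' T)) {c : Tor S} (hc : c ∈ tors S q) :
    g • c = c := by
  have h1 : Subgroup.closure (s '' T) ≤ MulAction.stabilizer (G F M) c := by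
    rw [Subgroup.closure_le]
    rintro _ ⟨l, hl, rfl⟩
    exact (hs l).smul_eq_self (mem_Tor_compl_of_mem_tors (fun h : q = l => hq (h ▸ hl)) hc)
  exact h1 hg

/-- On the `ℓ`-torsion for finitely many `ℓ`, any element of `G` acts like a product of powers of
the `σ_ℓ`. -/
theorem exists_mem_closure_smul_eq {s : KPrime F M → G F M}
    (hs : ∀ l, IsInertiaGenerator l (s l)) (g : G F M) (T : Finset (KPrime F M)) :
    ∃ t ∈ Subgroup.closure (s '' (T : Set (KPrime F M))),
      ∀ l ∈ T, ∀ c ∈ tors S l, t • c = g • c := by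
  classical
  induction T using Finset.induction_on with
  | empty => exact ⟨1, Subgroup.one_mem _, by simp⟩
  | insert q T hq ih =>
    obtain ⟨t, ht, htc⟩ := ih
    obtain ⟨j, hj⟩ := (hs q).mem_zpowers_torsionChar (torsionChar q g)
    replace hj : torsionChar q (s q) ^ j = torsionChar q g := hj
    have hsub : s '' (T : Set (KPrime F M)) ⊆ s '' ((insert q T : Finset (KPrime F M)) : Set _) :=
      Set.image_mono (by simp)
    have hqmem : s q ∈ Subgroup.closure (s '' ({q} : Set (KPrime F M))) :=
      Subgroup.subset_closure ⟨q, rfl, rfl⟩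
    have hqmem' : s q ∈ Subgroup.closure (s '' ((insert q T : Finset (KPrime F M)) : Set _)) :=
      Subgroup.subset_closure ⟨q, by simp, rfl⟩
    refine ⟨s q ^ j * t, Subgroup.mul_mem _ (Subgroup.zpow_mem _ hqmem' j)
      (Subgroup.closure_mono hsub ht), fun l hl c hc => ?_⟩
    rw [mul_smul]
    rcases Finset.mem_insert.1 hl with rfl | hlT
    · rw [smul_eq_self_of_mem_closure hs (by simpa using hq) ht hc,
        smul_eq_torsionChar _ (mem_tors.1 hc), smul_eq_torsionChar _ (mem_tors.1 hc), map_zpow, hj]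
    · rw [htc l hlT c hc]
      refine smul_eq_self_of_mem_closure hs (T := {q}) (q := l) ?_ (Subgroup.zpow_mem _ hqmem j) ?_
      · rintro rfl; exact hq hlT
      · rw [mem_tors, smul_comm, mem_tors.1 hc, smul_zero]

/-- The group `G` acts on `U_r` through the subgroup generated by the `σ_ℓ` with `ℓ ∣ r`. -/
theorem exists_repU_eq {s : KPrime F M → G F M} (hs : ∀ l, IsInertiaGenerator l (s l))
    (r : Divisor F M) (g : G F M) :
    ∃ t ∈ Subgroup.closure (s '' r.primes), repU r.primes g = repU r.primes t := by
  classical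
  have hfin : r.primes.Finite := by
    refine ((Set.finite_Iic (r : ℕ)).preimage
      (f := ((↑) : KPrime F M → ℕ)) Subtype.val_injective.injOn).subset fun l hl => ?_
    exact Nat.le_of_dvd (Nat.pos_of_ne_zero r.ne_zero) hl
  obtain ⟨t, ht, htc⟩ := exists_mem_closure_smul_eq (S := r.primes) hs g hfin.toFinset
  rw [Set.Finite.coe_toFinset] at ht
  refine ⟨t, ht, repU_congr fun a => ?_⟩
  obtain ⟨n, hn, ha⟩ := a.2
  let H : AddSubgroup (Tor r.primes) :=
    { carrier := {a | g • a = t • a}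
      zero_mem' := by simp
      add_mem' := fun {a b} ha hb => by
        rw [Set.mem_ofPred_eq] at ha hb ⊢
        rw [smul_add, smul_add, ha, hb]
      neg_mem' := fun {a} ha => by
        rw [Set.mem_ofPred_eq] at ha ⊢
        rw [smul_neg, smul_neg, ha] }
  refine mem_of_nsmul_eq_zero H n.2.1 (fun p hp hpn c hc => ?_) (Subtype.ext ha)
  exact (htc ⟨p, n.2.2 p hp hpn⟩ (hfin.mem_toFinset.2 (hn hpn)) c (mem_tors.2 hc)).symm

theorem exists_eq_mul_sub_one (l : KPrime F M) : ∃ k : ℤ, ((l : ℕ) : ℤ) - 1 = M * k :=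
  (Nat.modEq_iff_dvd.1 l.2.2.2.1.symm)

/-- The element `N'_r x_r` is invariant modulo `M`. By induction, `N'_{r/ℓ} x_{r/ℓ}` is invariant
under `Frob_ℓ` modulo `M`; as `M ∣ ℓ - 1`, the identity for `(σ_ℓ - 1) N'_r x_r` shows the
invariance under each `σ_ℓ`. -/
theorem kolyvaginElt_invariant {s f : KPrime F M → G F M}
    (hs : ∀ l, IsInertiaGenerator l (s l)) (hf : ∀ l, IsFrobenius l (f l)) (r : Divisor F M) :
    red (kolyvaginElt s r) ∈ H0 r.primes := by
  induction hn : (r : ℕ) using Nat.strong_induction_on generalizing r with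
  | _ n ih =>
    subst hn
    have hincl : ∀ x : U r.primes, incl subset_rfl x = x := fun x => LinearMap.congr_fun
      (f := incl subset_rfl) (g := LinearMap.id) (linearMap_ext_symU fun a => incl_symU _ a) x
    -- It suffices to treat the generators of the inertia groups at the primes dividing `r`.
    have key : ∀ l ∈ r.primes, ∃ w, repU r.primes (s l) (kolyvaginElt s r) - kolyvaginElt s r =
        (M : ℤ) • w := by
      intro l hl
      have h1 := repU_kolyvaginElt_sub hs hf (subset_rfl : r.primes ⊆ r.primes) (hl : (l : ℕ) ∣ r)
      obtain ⟨w, hw⟩ := red_mem_H0.1 (ih _ (Nat.div_lt_self (Nat.pos_of_ne_zero r.ne_zero)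
        l.2.1.one_lt) (r.quot l hl) rfl) (f l)
      obtain ⟨k, hk⟩ := exists_eq_mul_sub_one l
      have h2 := congrArg (incl ((primes_quot_subset r l hl).trans subset_rfl)) hw
      rw [map_sub, map_smul, ← repU_incl] at h2
      rw [h2, hincl, hk, mul_smul, ← smul_sub] at h1
      exact ⟨_, h1⟩
    let H : Subgroup (G F M) :=
      { carrier := {g | red (repU r.primes g (kolyvaginElt s r)) = red (kolyvaginElt s r)}
        one_mem' := by simp
        mul_mem' := fun {a b} ha hb => by
          rw [Set.mem_ofPred_eq] at ha hb ⊢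
          rw [map_mul, Module.End.mul_apply]
          exact (congrArg (repUM r.primes a) hb).trans ha
        inv_mem' := fun {a} ha => by
          rw [Set.mem_ofPred_eq] at ha ⊢
          have h2 := congrArg (repUM r.primes a⁻¹) ha
          exact h2.symm.trans ((repUM r.primes).inv_self_apply a (red (kolyvaginElt s r))) }
    rw [red_mem_H0]
    intro g
    obtain ⟨t, ht, hgt⟩ := exists_repU_eq hs r g
    have h3 : Subgroup.closure (s '' r.primes) ≤ H := by
      rw [Subgroup.closure_le]
      rintro _ ⟨l, hl, rfl⟩
      obtain ⟨w, hw⟩ := key l hl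
      exact (Submodule.Quotient.eq _).2 ⟨w, hw.symm⟩
    obtain ⟨w, hw⟩ := (Submodule.Quotient.eq _).1 (h3 ht)
    exact ⟨w, by rw [hgt]; exact hw.symm⟩

/-! ### The subgroup `I_ℓ` and the Euler factor `ℓ - Frob_ℓ` -/

theorem symU_sub_mem_I {l : KPrime F M} {a b : Tor (Set.univ : Set (KPrime F M))}
    (h : (l : ℕ) • (a - b) = 0) : symU a - symU b ∈ I l :=
  Submodule.subset_span ⟨a, b, h, rfl⟩

theorem repU_mem_I {l : KPrime F M} (g : G F M) {x : U (Set.univ : Set (KPrime F M))}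
    (hx : x ∈ I l) : repU _ g x ∈ I l := by
  have h1 : I l ≤ (I l).comap (repU Set.univ g) := by
    refine Submodule.span_le.2 ?_
    rintro _ ⟨a, b, hab, rfl⟩
    change repU Set.univ g (symU a - symU b) ∈ I l
    rw [map_sub, repU_symU, repU_symU]
    exact symU_sub_mem_I (by rw [← smul_sub, smul_comm, hab, smul_zero])
  exact h1 hx

theorem repU_sub_mem_I {l : KPrime F M} {s : G F M} (hs : IsInertiaGenerator l s)
    (x : U (Set.univ : Set (KPrime F M))) : repU _ s x - x ∈ I l := by
  induction x using induction_symU with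
  | hsym a =>
    rw [repU_symU]
    refine symU_sub_mem_I ?_
    have h1 : s • (l : ℕ) • a = (l : ℕ) • a := hs.smul_eq_self (nsmul_mem_Tor_compl l a.2)
    rw [smul_sub, ← smul_comm, h1, sub_self]
  | hzero => simp
  | hadd x y hx hy => rw [map_add, add_sub_add_comm]; exact Submodule.add_mem _ hx hy
  | hneg x hx => rw [map_neg, ← neg_sub', neg_mem_iff]; exact hx

/-- `U = U_{𝐫/ℓ} + I_ℓ`. -/
theorem exists_sub_incl_mem_I (l : KPrime F M) (u : U (Set.univ : Set (KPrime F M))) :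
    ∃ v : U ({l}ᶜ : Set (KPrime F M)), u - incl (Set.subset_univ _) v ∈ I l := by
  induction u using induction_symU with
  | hsym a =>
    obtain ⟨b, hb, hab⟩ := exists_compl_part l a
    refine ⟨symU ⟨b, hb⟩, ?_⟩
    rw [incl_symU]
    exact symU_sub_mem_I hab
  | hzero => exact ⟨0, by simp⟩
  | hadd x y hx hy =>
    obtain ⟨v, hv⟩ := hx
    obtain ⟨w, hw⟩ := hy
    exact ⟨v + w, by rw [map_add, add_sub_add_comm]; exact Submodule.add_mem _ hv hw⟩
  | hneg x hx =>
    obtain ⟨v, hv⟩ := hx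
    exact ⟨-v, by rw [map_neg, ← neg_sub', neg_mem_iff]; exact hv⟩

/-- The operator `ℓ - Frob_ℓ` on `U_{𝐫/ℓ}`. -/
def eulerFactor (l : KPrime F M) (f : G F M) :
    U ({l}ᶜ : Set (KPrime F M)) →ₗ[ℤ] U ({l}ᶜ : Set (KPrime F M)) :=
  ((l : ℕ) : ℤ) • LinearMap.id - repU _ f

theorem eulerFactor_apply (l : KPrime F M) (f : G F M) (y : U ({l}ᶜ : Set (KPrime F M))) :
    eulerFactor l f y = ((l : ℕ) : ℤ) • y - repU _ f y := rfl

theorem eulerFactor_repU (l : KPrime F M) (f g : G F M) (y : U ({l}ᶜ : Set (KPrime F M))) :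
    eulerFactor l f (repU _ g y) = repU _ g (eulerFactor l f y) := by
  rw [eulerFactor_apply, eulerFactor_apply, map_sub, map_smul]
  congr 1
  exact LinearMap.congr_fun (repU_comm f g).eq y

/-- `(ℓ - Frob_ℓ) U_{𝐫/ℓ} ⊆ I_ℓ`: as `Frob_ℓ [b] = [ℓ b] = ∑_{ℓ c = 0} [b + c]`, the element
`(ℓ - Frob_ℓ) [b]` is the sum of the `[b] - [b + c]`. -/
theorem incl_eulerFactor_mem_I {l : KPrime F M} {f : G F M} (hf : IsFrobenius l f)
    (y : U ({l}ᶜ : Set (KPrime F M))) :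
    incl (Set.subset_univ _) (eulerFactor l f y) ∈ I l := by
  induction y using induction_symU with
  | hsym a =>
    rw [eulerFactor_apply, map_sub, map_smul, ← repU_incl, incl_symU, repU_symU]
    set b := AddSubgroup.inclusion (Tor_mono (Set.subset_univ ({l}ᶜ : Set (KPrime F M)))) a
    have hb : (b : AddCircle (1 : ℚ)) ∈ Tor ({l}ᶜ : Set (KPrime F M)) := a.2
    have h1 : ((l : ℕ) : ℤ) • symU b = ∑ c ∈ tors Set.univ l, symU b := by
      rw [Finset.sum_const, card_tors (Set.mem_univ l), natCast_zsmul]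
    rw [hf.smul_eq hb, ← sum_symU_add_tors (Set.mem_univ l) hb, h1, ← Finset.sum_sub_distrib]
    refine Submodule.sum_mem _ fun c hc => symU_sub_mem_I ?_
    rw [sub_add_cancel_left, smul_neg, mem_tors.1 hc, neg_zero]
  | hzero => simp
  | hadd x y hx hy => rw [map_add, map_add]; exact Submodule.add_mem _ hx hy
  | hneg x hx => rw [map_neg, map_neg, neg_mem_iff]; exact hx

/-- Multiplication by `ℓ`, as a map from `(1/𝐫)ℤ/ℤ` to its subgroup `(1/(𝐫/ℓ))ℤ/ℤ`. -/
def mulToCompl (l : KPrime F M) (a : Tor (Set.univ : Set (KPrime F M))) :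
    Tor ({l}ᶜ : Set (KPrime F M)) :=
  ⟨(l : ℕ) • (a : AddCircle (1 : ℚ)), nsmul_mem_Tor_compl l a.2⟩

theorem mulToCompl_add (l : KPrime F M) (a b : Tor (Set.univ : Set (KPrime F M))) :
    mulToCompl l (a + b) = mulToCompl l a + mulToCompl l b :=
  Subtype.ext (smul_add _ _ _)

theorem mulToCompl_nsmul (l : KPrime F M) (n : ℕ) (a : Tor (Set.univ : Set (KPrime F M))) :
    mulToCompl l (n • a) = n • mulToCompl l a :=
  Subtype.ext (smul_comm _ _ _)

/-- Multiplication by `ℓ` is constant modulo `(1/ℓ)ℤ/ℤ`. -/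
theorem mulToCompl_eq {l : KPrime F M} {a b : Tor (Set.univ : Set (KPrime F M))}
    (h : (l : ℕ) • (a - b) = 0) : mulToCompl l a = mulToCompl l b := by
  rw [smul_sub, sub_eq_zero] at h
  have h1 := congrArg Subtype.val h
  exact Subtype.ext h1

theorem sum_mulToCompl_tors {V : Type*} [AddCommMonoid V] {l q : KPrime F M} (hql : q ≠ l)
    (φ : Tor ({l}ᶜ : Set (KPrime F M)) → V) :
    ∑ c ∈ tors Set.univ q, φ (mulToCompl l c) = ∑ d ∈ tors ({l}ᶜ : Set (KPrime F M)) q, φ d := by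
  have hmaps : ∀ c ∈ tors Set.univ q, mulToCompl l c ∈ tors ({l}ᶜ : Set (KPrime F M)) q :=
    fun c hc => by
      rw [mem_tors] at hc ⊢
      rw [← mulToCompl_nsmul, hc]
      exact Subtype.ext (smul_zero _)
  have hinj : Set.InjOn (mulToCompl l) (tors (Set.univ : Set (KPrime F M)) q) := by
    intro c hc d hd hcd
    have h1 : (l : ℕ) • (c - d) = 0 := by
      have h2 := congrArg Subtype.val hcd
      rw [smul_sub, sub_eq_zero]
      exact Subtype.ext h2
    exact sub_eq_zero.1 (eq_zero_of_mem_tors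
      (mem_Tor_compl_of_mem_tors hql (sub_mem_tors hc hd)) (mem_tors.2 h1))
  refine Finset.sum_bij (fun c _ => mulToCompl l c) hmaps (fun c hc d hd h => hinj hc hd h)
    (fun d hd => ?_) (fun _ _ => rfl)
  obtain ⟨c, hc, h⟩ := Finset.surjOn_of_injOn_of_card_le _ hmaps hinj
    (by rw [card_tors (Set.mem_univ q), card_tors (show q ∈ ({l}ᶜ : Set (KPrime F M)) from hql)]) hd
  exact ⟨c, hc, h⟩

/-- The map `[a] ↦ [ℓ a]` from `U` to `U_{𝐫/ℓ} / (ℓ - Frob_ℓ) U_{𝐫/ℓ}` is well defined: a relation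
at `q ≠ ℓ` goes to a relation at `q`, and the relation `[ℓ b] = ∑_{ℓ c = 0} [b + c]` at `ℓ` goes to
`Frob_ℓ [ℓ b] = ℓ [ℓ b]`. -/
theorem exists_projection {l : KPrime F M} {f : G F M} (hf : IsFrobenius l f) :
    ∃ π : U (Set.univ : Set (KPrime F M)) →ₗ[ℤ]
        U ({l}ᶜ : Set (KPrime F M)) ⧸ LinearMap.range (eulerFactor l f),
      ∀ a, π (symU a) = Submodule.Quotient.mk (symU (mulToCompl l a)) := by
  let π₀ : A (Set.univ : Set (KPrime F M)) →ₗ[ℤ]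
      U ({l}ᶜ : Set (KPrime F M)) ⧸ LinearMap.range (eulerFactor l f) :=
    Finsupp.linearCombination ℤ fun a => Submodule.Quotient.mk (symU (mulToCompl l a))
  have hπ₀ : ∀ a, π₀ (sym a) = Submodule.Quotient.mk (symU (mulToCompl l a)) := fun a => by
    simp [π₀, sym]
  have hker : relations Set.univ ≤ LinearMap.ker π₀ := by
    refine Submodule.span_le.2 fun z hz => ?_
    obtain ⟨q, -, b, hb, rfl⟩ := isRelation_iff.1 hz
    rw [SetLike.mem_coe, LinearMap.mem_ker, eulerRel, map_sub, map_sum]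
    simp only [hπ₀, mulToCompl_add, mulToCompl_nsmul]
    by_cases hql : q = l
    · subst hql
      have h1 : ∀ c ∈ tors Set.univ q, mulToCompl q b + mulToCompl q c = mulToCompl q b := by
        intro c hc
        rw [add_eq_left]
        have h2 := congrArg Subtype.val (mem_tors.1 hc)
        exact Subtype.ext h2
      rw [Finset.sum_congr rfl (fun c hc => by rw [h1 c hc]), Finset.sum_const,
        card_tors (Set.mem_univ q), ← hf.smul_eq (mulToCompl q b).2, ← repU_symU,
        ← Submodule.Quotient.mk_smul, ← Submodule.Quotient.mk_sub, Submodule.Quotient.mk_eq_zero,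
        ← neg_mem_iff, neg_sub, ← natCast_zsmul]
      exact ⟨_, rfl⟩
    · rw [sum_mulToCompl_tors hql (fun d => (Submodule.Quotient.mk (symU (mulToCompl l b + d)) :
        U ({l}ᶜ : Set (KPrime F M)) ⧸ LinearMap.range (eulerFactor l f)))]
      have hb' : (mulToCompl l b : AddCircle (1 : ℚ)) ∈ Tor ({q}ᶜ : Set (KPrime F M)) :=
        AddSubgroup.nsmul_mem _ hb _
      have h1 := congrArg (Submodule.mkQ (LinearMap.range (eulerFactor l f)))
        (sum_symU_add_tors (S := {l}ᶜ) hql hb')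
      rw [map_sum] at h1
      exact sub_eq_zero.2 h1.symm
  exact ⟨(relations Set.univ).liftQ π₀ hker, fun a => hπ₀ a⟩

/-- An element of `U_{𝐫/ℓ}` that lies in `I_ℓ` is in `(ℓ - Frob_ℓ) U_{𝐫/ℓ}`: the map `[a] ↦ [ℓ a]`
to the quotient kills `I_ℓ`, and is `Frob_ℓ` on `U_{𝐫/ℓ}`. -/
theorem mem_range_eulerFactor {l : KPrime F M} {f : G F M} (hf : IsFrobenius l f)
    {v : U ({l}ᶜ : Set (KPrime F M))} (hv : incl (Set.subset_univ _) v ∈ I l) :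
    ∃ w, eulerFactor l f w = v := by
  obtain ⟨π, hπ⟩ := exists_projection hf
  have hI : I l ≤ LinearMap.ker π := by
    refine Submodule.span_le.2 ?_
    rintro _ ⟨a, b, hab, rfl⟩
    change π (symU a - symU b) = 0
    rw [map_sub, hπ, hπ, mulToCompl_eq hab, sub_self]
  have h1 : π ∘ₗ incl (Set.subset_univ _) =
      (LinearMap.range (eulerFactor l f)).mkQ ∘ₗ repU _ f := by
    refine linearMap_ext_symU fun a => ?_
    rw [LinearMap.comp_apply, LinearMap.comp_apply, incl_symU, hπ, repU_symU, hf.smul_eq a.2]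
    rfl
  have h2 := LinearMap.congr_fun h1 v
  rw [LinearMap.comp_apply, LinearMap.comp_apply, LinearMap.mem_ker.1 (hI hv)] at h2
  obtain ⟨w, hw⟩ := (Submodule.Quotient.mk_eq_zero _).1 h2.symm
  refine ⟨repU _ f⁻¹ w, ?_⟩
  rw [eulerFactor_repU, hw]
  exact (repU _).inv_self_apply f v

/-- Each element of `U_{𝐫/ℓ}` has a finite orbit under `Frob_ℓ`. -/
theorem exists_isPeriodicPt_repU {l : KPrime F M} {f : G F M} (hf : IsFrobenius l f)
    (y : U ({l}ᶜ : Set (KPrime F M))) :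
    ∃ n : ℕ, 0 < n ∧ Function.IsPeriodicPt (repU ({l}ᶜ : Set (KPrime F M)) f) n y := by
  induction y using induction_symU with
  | hsym a =>
    obtain ⟨N, hN, hN0, ha⟩ := exists_nsmul_of_mem_compl a.2
    have h1 : ∀ k : ℕ,
        (repU ({l}ᶜ : Set (KPrime F M)) f)^[k] (symU a) = symU ((l : ℕ) ^ k • a) := by
      intro k
      induction k with
      | zero => simp
      | succ k ih =>
        rw [Function.iterate_succ_apply', ih, repU_symU, hf.smul_eq (Subtype.prop _), smul_smul,
          pow_succ']
    refine ⟨N.totient, Nat.totient_pos.2 (Nat.pos_of_ne_zero hN0), ?_⟩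
    rw [Function.IsPeriodicPt, Function.IsFixedPt, h1]
    congr 1
    conv_rhs => rw [← one_smul ℕ a]
    rw [nsmul_eq_nsmul_iff_modEq]
    exact (Nat.ModEq.pow_totient hN.symm).of_dvd
      (addOrderOf_dvd_of_nsmul_eq_zero (Subtype.ext ha))
  | hzero => exact ⟨1, one_pos, map_zero _⟩
  | hadd x y hx hy =>
    obtain ⟨m, hm, hx⟩ := hx
    obtain ⟨n, hn, hy⟩ := hy
    refine ⟨m * n, Nat.mul_pos hm hn, ?_⟩
    have h1 := hx.mul_const n
    have h2 := hy.const_mul m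
    rw [Function.IsPeriodicPt, Function.IsFixedPt] at h1 h2 ⊢
    rw [iterate_map_add, h1, h2]
  | hneg x hx =>
    obtain ⟨n, hn, hx⟩ := hx
    refine ⟨n, hn, ?_⟩
    rw [Function.IsPeriodicPt, Function.IsFixedPt] at hx ⊢
    rw [iterate_map_neg, hx]

/-- If `Frob_ℓ y = ℓ y`, then `y = Frob_ℓ ^ n y = ℓ ^ n y` for some `n > 0`, so `y = 0` as `U_{𝐫/ℓ}`
is torsion-free. -/
theorem eulerFactor_injective {l : KPrime F M} {f : G F M} (hf : IsFrobenius l f) :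
    Function.Injective (eulerFactor l f) := by
  rw [injective_iff_map_eq_zero]
  intro y hy
  rw [eulerFactor_apply, sub_eq_zero] at hy
  obtain ⟨n, hn, hper⟩ := exists_isPeriodicPt_repU hf y
  have h1 : ∀ k : ℕ, (repU ({l}ᶜ : Set (KPrime F M)) f)^[k] y = (((l : ℕ) : ℤ) ^ k) • y := by
    intro k
    induction k with
    | zero => simp
    | succ k ih =>
      rw [Function.iterate_succ_apply', ih, map_smul, ← hy, smul_smul, pow_succ]
  have h2 : (((l : ℕ) : ℤ) ^ n - 1) • y = 0 := by
    rw [sub_smul, ← h1, one_smul, hper.eq, sub_self]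
  refine smul_eq_zero_U (sub_ne_zero.2 ?_) h2
  exact_mod_cast (Nat.one_lt_pow hn.ne' l.2.1.one_lt).ne'

/-! ### The operator `D_ℓ` and the recursion -/

/-- The relation `(σ_ℓ - 1) x / M ≡ (ℓ - Frob_ℓ) y / M mod I_ℓ` that defines the graph of `D_ℓ`. -/
def DRelation (l : KPrime F M) (s f : G F M) (x : U (Set.univ : Set (KPrime F M)))
    (y : U ({l}ᶜ : Set (KPrime F M))) : Prop :=
  ∃ (u : U (Set.univ : Set (KPrime F M))) (v : U ({l}ᶜ : Set (KPrime F M))),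
    (M : ℤ) • u = repU _ s x - x ∧ (M : ℤ) • v = ((l : ℕ) : ℤ) • y - repU _ f y ∧
      u - incl (Set.subset_univ _) v ∈ I l

theorem DRelation.add {l : KPrime F M} {s f : G F M} {x x' y y'} (h : DRelation l s f x y)
    (h' : DRelation l s f x' y') : DRelation l s f (x + x') (y + y') := by
  obtain ⟨u, v, hu, hv, huv⟩ := h
  obtain ⟨u', v', hu', hv', huv'⟩ := h'
  refine ⟨u + u', v + v', ?_, ?_, ?_⟩
  · rw [smul_add, hu, hu', map_add]; abel
  · rw [smul_add, hv, hv', map_add, smul_add]; abel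
  · rw [map_add, add_sub_add_comm]; exact Submodule.add_mem _ huv huv'

theorem DRelation.neg {l : KPrime F M} {s f : G F M} {x y} (h : DRelation l s f x y) :
    DRelation l s f (-x) (-y) := by
  obtain ⟨u, v, hu, hv, huv⟩ := h
  refine ⟨-u, -v, ?_, ?_, ?_⟩
  · rw [smul_neg, hu, map_neg]; abel
  · rw [smul_neg, hv, map_neg, smul_neg]; abel
  · rw [map_neg, ← neg_sub', neg_mem_iff]; exact huv

theorem DRelation.map {l : KPrime F M} {s f : G F M} {x y} (h : DRelation l s f x y) (g : G F M) :
    DRelation l s f (repU _ g x) (repU _ g y) := by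
  obtain ⟨u, v, hu, hv, huv⟩ := h
  refine ⟨repU _ g u, repU _ g v, ?_, ?_, ?_⟩
  · rw [← map_smul, hu, map_sub]
    congr 1
    exact LinearMap.congr_fun (repU_comm g s).eq x
  · rw [← map_smul, hv]
    exact (eulerFactor_repU l f g y).symm
  · rw [← repU_incl, ← map_sub]
    exact repU_mem_I g huv

/-- Each `x` that is invariant modulo `M` is related to some `y`: write `(σ_ℓ - 1) x = M u` and
`u ≡ v mod I_ℓ` with `v ∈ U_{𝐫/ℓ}`. Then `M v ∈ I_ℓ`, so `M v = (ℓ - Frob_ℓ) y`. -/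
theorem exists_DRelation {l : KPrime F M} {s f : G F M} (hs : IsInertiaGenerator l s)
    (hf : IsFrobenius l f) {x : U (Set.univ : Set (KPrime F M))} (hx : red x ∈ H0 Set.univ) :
    ∃ y, DRelation l s f x y := by
  obtain ⟨u, hu⟩ := red_mem_H0.1 hx s
  obtain ⟨v, hv⟩ := exists_sub_incl_mem_I l u
  have h1 : incl (Set.subset_univ _) ((M : ℤ) • v) ∈ I l := by
    have h2 := Submodule.sub_mem _ (repU_sub_mem_I hs x) (Submodule.smul_mem _ (M : ℤ) hv)
    rw [hu, smul_sub, sub_sub_cancel] at h2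
    rwa [map_smul]
  obtain ⟨y, hy⟩ := mem_range_eulerFactor hf h1
  exact ⟨y, u, v, hu.symm, hy.symm, hv⟩

/-- If `x` is divisible by `M`, then so is every `y` related to it. -/
theorem DRelation.exists_eq_smul {l : KPrime F M} {s f : G F M} (hM : M ≠ 0)
    (hs : IsInertiaGenerator l s) (hf : IsFrobenius l f) {t y}
    (h : DRelation l s f ((M : ℤ) • t) y) : ∃ w, y = (M : ℤ) • w := by
  have hM' : (M : ℤ) ≠ 0 := by exact_mod_cast hM
  obtain ⟨u, v, hu, hv, huv⟩ := h
  have h1 : u = repU _ s t - t := by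
    rw [← sub_eq_zero]
    refine smul_eq_zero_U hM' ?_
    rw [smul_sub, hu, map_smul, smul_sub, sub_self]
  -- As `u` lies in `I_ℓ`, so does `v`, and `v = (ℓ - Frob_ℓ) w`.
  have h2 : incl (Set.subset_univ _) v ∈ I l := by
    have h3 := Submodule.sub_mem _ (h1 ▸ repU_sub_mem_I hs t) huv
    rwa [sub_sub_cancel] at h3
  obtain ⟨w, rfl⟩ := mem_range_eulerFactor hf h2
  refine ⟨w, eulerFactor_injective hf ?_⟩
  rw [map_smul, hv, eulerFactor_apply]

theorem DRelation.add_smul {l : KPrime F M} {s f : G F M} (hf : IsFrobenius l f) {x y}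
    (h : DRelation l s f x y) (w : U ({l}ᶜ : Set (KPrime F M))) :
    DRelation l s f x (y + (M : ℤ) • w) := by
  obtain ⟨u, v, hu, hv, huv⟩ := h
  refine ⟨u, v + eulerFactor l f w, hu, ?_, ?_⟩
  · rw [smul_add, hv, eulerFactor_apply, map_add, map_smul]
    module
  · rw [map_add, ← sub_sub]
    exact Submodule.sub_mem _ huv (incl_eulerFactor_mem_I hf w)

theorem red_eq_red {S : Set (KPrime F M)} {x x' : U S} :
    red x = red x' ↔ ∃ w, x = x' + (M : ℤ) • w := by
  rw [Submodule.Quotient.eq]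
  constructor
  · rintro ⟨w, hw⟩
    refine ⟨w, ?_⟩
    rw [show (M : ℤ) • w = x - x' from hw]
    abel
  · rintro ⟨w, rfl⟩
    exact ⟨w, by simp⟩

theorem DRelation.red_eq {l : KPrime F M} {s f : G F M} (hM : M ≠ 0)
    (hs : IsInertiaGenerator l s) (hf : IsFrobenius l f) {x x' y y'} (h : DRelation l s f x y)
    (h' : DRelation l s f x' y') (hxx' : red x = red x') : red y = red y' := by
  obtain ⟨t, rfl⟩ := red_eq_red.1 hxx'
  have h1 := h.add h'.neg
  rw [add_neg_cancel_comm] at h1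
  obtain ⟨w, hw⟩ := h1.exists_eq_smul hM hs hf
  exact red_eq_red.2 ⟨w, by rw [← hw]; abel⟩

/-- As the relation is `G`-equivariant and `y mod M` depends only on `x mod M`, the class of `y` is
invariant if that of `x` is. -/
theorem DRelation.red_mem {l : KPrime F M} {s f : G F M} (hM : M ≠ 0)
    (hs : IsInertiaGenerator l s) (hf : IsFrobenius l f) {x y} (h : DRelation l s f x y)
    (hx : red x ∈ H0 Set.univ) : red y ∈ H0 ({l}ᶜ : Set (KPrime F M)) := by
  rw [Representation.mem_invariants]
  intro g
  exact (h.map g).red_eq hM hs hf h ((Representation.mem_invariants _ _).1 hx g)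

theorem exists_isDOperator {l : KPrime F M} {s f : G F M} (hM : M ≠ 0)
    (hs : IsInertiaGenerator l s) (hf : IsFrobenius l f) : ∃ D, IsDOperator l s f D := by
  have hex : ∀ ξ : H0 (Set.univ : Set (KPrime F M)), ∃ η : H0 ({l}ᶜ : Set (KPrime F M)),
      ∃ x y, red x = (ξ : UM Set.univ) ∧ red y = (η : UM ({l}ᶜ : Set (KPrime F M))) ∧
        DRelation l s f x y := by
    rintro ⟨ξ, hξ⟩
    obtain ⟨x, rfl⟩ := Submodule.Quotient.mk_surjective _ ξ
    obtain ⟨y, hy⟩ := exists_DRelation hs hf hξ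
    exact ⟨⟨red y, hy.red_mem hM hs hf hξ⟩, x, y, rfl, rfl, hy⟩
  choose D hD using hex
  have hadd : ∀ ξ ξ', D (ξ + ξ') = D ξ + D ξ' := by
    intro ξ ξ'
    obtain ⟨x, y, hx, hy, hxy⟩ := hD ξ
    obtain ⟨x', y', hx', hy', hxy'⟩ := hD ξ'
    obtain ⟨x₂, y₂, hx₂, hy₂, hxy₂⟩ := hD (ξ + ξ')
    refine Subtype.ext ?_
    rw [Submodule.coe_add, ← hy, ← hy', ← hy₂, ← Submodule.Quotient.mk_add]
    refine hxy₂.red_eq hM hs hf (hxy.add hxy') ?_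
    rw [hx₂, Submodule.coe_add, ← hx, ← hx', ← Submodule.Quotient.mk_add]
  refine ⟨(AddMonoidHom.mk' D hadd).toIntLinearMap, fun x y hx hy => ?_⟩
  obtain ⟨x', y', hx', hy', hxy'⟩ := hD ⟨red x, hx⟩
  change DRelation l s f x y ↔ D ⟨red x, hx⟩ = ⟨red y, hy⟩
  constructor
  · intro h
    refine Subtype.ext ?_
    rw [← hy']
    exact hxy'.red_eq hM hs hf h hx'
  · intro h
    obtain ⟨y₂, hy₂⟩ := exists_DRelation hs hf hx
    have h1 : red y = red y₂ := by
      have h2 := hxy'.red_eq hM hs hf hy₂ hx'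
      rw [hy', h] at h2
      exact h2
    obtain ⟨w, rfl⟩ := red_eq_red.1 h1
    exact hy₂.add_smul hf w

theorem IsDOperator.unique {l : KPrime F M} {s f : G F M}
    {D D' : H0 (Set.univ : Set (KPrime F M)) →ₗ[ℤ] H0 ({l}ᶜ : Set (KPrime F M))}
    (hD : IsDOperator l s f D) (hD' : IsDOperator l s f D') : D' = D := by
  ext1 ⟨ξ, hξ⟩
  obtain ⟨x, rfl⟩ := Submodule.Quotient.mk_surjective _ ξ
  obtain ⟨η, hη⟩ : ∃ η, D ⟨red x, hξ⟩ = η := ⟨_, rfl⟩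
  obtain ⟨η, hη'⟩ := η
  obtain ⟨y, rfl⟩ := Submodule.Quotient.mk_surjective _ η
  exact ((hD' x y hξ hη').1 ((hD x y hξ hη').2 hη)).trans hη.symm

theorem inclM_red_mem_H0 {S : Set (KPrime F M)} {x : U S} (hx : red x ∈ H0 S) :
    inclM (Set.subset_univ _) (red x) ∈ H0 (Set.univ : Set (KPrime F M)) := by
  change red (incl (Set.subset_univ _) x) ∈ _
  rw [red_mem_H0] at hx ⊢
  intro g
  obtain ⟨w, hw⟩ := hx g
  exact ⟨incl (Set.subset_univ _) w, by rw [repU_incl, ← map_sub, hw, map_smul]⟩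

/-- `N'_r x_r` is related to `N'_{r/ℓ} x_{r/ℓ}`. With `ℓ - 1 = M k` and
`(Frob_ℓ - 1) N'_{r/ℓ} x_{r/ℓ} = M w`, both quotients by `M` contain the term `-w`, and they differ
by `k N'_{r/ℓ} (x_r - x_{r/ℓ})`, which is in `I_ℓ` since `x_r = [b + 1/ℓ]` and `x_{r/ℓ} = [b]`. -/
theorem DRelation_kolyvaginElt {s f : KPrime F M → G F M} (hs : ∀ l, IsInertiaGenerator l (s l))
    (hf : ∀ l, IsFrobenius l (f l)) (r : Divisor F M) (l : KPrime F M) (h : (l : ℕ) ∣ r) :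
    DRelation l (s l) (f l) (incl (Set.subset_univ _) (kolyvaginElt s r))
      (incl (primes_quot_subset_compl r l h) (kolyvaginElt s (r.quot l h))) := by
  obtain ⟨k, hk⟩ := exists_eq_mul_sub_one l
  obtain ⟨w, hw⟩ := red_mem_H0.1 (kolyvaginElt_invariant hs hf (r.quot l h)) (f l)
  obtain ⟨b, hb, hxr, hxq⟩ := exists_xElt_quot (Set.subset_univ r.primes) h (Set.mem_univ l)
  have h1 := repU_kolyvaginElt_sub hs hf (Set.subset_univ r.primes) h
  have h2 := congrArg (incl ((primes_quot_subset r l h).trans (Set.subset_univ r.primes))) hw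
  rw [map_sub, map_smul, ← repU_incl] at h2
  rw [h2, hk, mul_smul, ← smul_sub] at h1
  refine ⟨_, k • incl (primes_quot_subset_compl r l h) (kolyvaginElt s (r.quot l h)) -
    incl (primes_quot_subset_compl r l h) w, h1.symm, ?_, ?_⟩
  · have h3 := congrArg (incl (primes_quot_subset_compl r l h)) hw
    rw [map_sub, map_smul, ← repU_incl] at h3
    rw [smul_sub, ← h3, smul_smul, ← hk]
    module
  · have h3 : ∀ x : U (r.quot l h).primes, incl (Set.subset_univ _)
        (incl (primes_quot_subset_compl r l h) x) = incl (Set.subset_univ _) x :=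
      fun x => incl_incl _ _ x
    rw [map_sub, map_smul, h3, h3, sub_sub_sub_cancel_right, ← smul_sub, incl_kolyvaginElt, hxq,
      hxr, ← map_sub]
    refine Submodule.smul_mem _ _ (asAlgebraHom_mem_of_stable _ (fun g x hx => repU_mem_I g hx) _
      (symU_sub_mem_I ?_))
    rw [add_sub_cancel_left, nsmul_invElt]

end UniversalKolyvagin

end

open UniversalKolyvagin in
theorem proposition4p1 (F : Type*) [Field F] [NumberField F] [IsAbelianGalois ℚ F]
    [NumberField.IsTotallyReal F] (M : ℕ) (hM : Odd M)
    (s : KPrime F M → G F M) (hs : ∀ l, IsInertiaGenerator l (s l))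
    (f : KPrime F M → G F M) (hf : ∀ l, IsFrobenius l (f l)) :
    ∃ c : Divisor F M → H0 (Set.univ : Set (KPrime F M)),
      (∀ r, red (kolyvaginElt s r) ∈ H0 r.primes ∧
        (c r : UM Set.univ) = inclM (Set.subset_univ _) (red (kolyvaginElt s r))) ∧
      ∃ D : ∀ l : KPrime F M,
          H0 (Set.univ : Set (KPrime F M)) →ₗ[ℤ] H0 ({l}ᶜ : Set (KPrime F M)),
        (∀ l, IsDOperator l (s l) (f l) (D l) ∧
          ∀ D', IsDOperator l (s l) (f l) D' → D' = D l) ∧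
        SatisfiesRecursion D c := by
  have hM0 : M ≠ 0 := hM.pos.ne'
  have hinv := kolyvaginElt_invariant hs hf
  choose D hD using fun l => exists_isDOperator hM0 (hs l) (hf l)
  refine ⟨fun r => ⟨_, inclM_red_mem_H0 (hinv r)⟩, fun r => ⟨hinv r, rfl⟩, D,
    fun l => ⟨hD l, fun D' hD' => (hD l).unique hD'⟩, fun r => ⟨⟨_, hinv r, rfl⟩, fun l h => ?_⟩⟩
  have hrel := DRelation_kolyvaginElt hs hf r l h
  have h1 := (hD l _ _ (inclM_red_mem_H0 (hinv r))
    (hrel.red_mem hM0 (hs l) (hf l) (inclM_red_mem_H0 (hinv r)))).1 hrel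
  refine (congrArg (fun η : H0 ({l}ᶜ : Set (KPrime F M)) =>
    inclM (Set.subset_univ _) (η : UM ({l}ᶜ : Set (KPrime F M)))) h1).trans ?_
  exact congrArg red (incl_incl _ _ _)
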